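/- Let $\mathcal N=\{1,\dots,n\}$ be a set of products, let an assortment be a nonempty subset of $\mathcal N$, and let $\mathcal S$ be a collection of assortments. A choice probability collection over $\mathcal S$ is a vector $p=(p_{i,S}: S\in\mathcal S,\ i\in S)$ with $p_{i,S}\ge 0$ and $\sum_{i\in S}p_{i,S}=1$ for every $S\in\mathcal S$. It is a point of the finite-dimensional real space indexed by the pairs $(i,S)$ with $S\in\mathcal S$, $i\in S$, and closures are taken there. The utility of product $i$ is $\nu_i+\tilde\epsilon_i$, with $\nu\in\mathbb R^n$ deterministic and $\tilde\epsilon$ a random vector in $\mathbb R^n$. - $\mathcal P_{\rm RUM}(\mathcal S)$ is the set of $p$ for which there are $\nu\in\mathbb R^n$ and a probability law $\theta$ of $\tilde\epsilon$, under which $\nu_i+\tilde\epsilon_i=\nu_j+\tilde\epsilon_j$ has probability $0$ for all $i\ne j$, such that $p_{i,S}=\mathbb P_\theta\big(i=\arg\max_{j\in S}\{\nu_j+\tilde\epsilon_j\}\big)$ for all $S\in\mathcal S$, $i\in S$. - $\mathcal P_{\rm MDM}(\mathcal S)$ is the set of $p$ for which there are $\nu\in\mathbb R^n$ and marginal laws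 $F_1,\dots,F_n$ on $\mathbb R$, each absolutely continuous, with finite mean and with a distribution function that is strictly increasing on its support, such that for every $S\in\mathcal S$ there is a joint law $\theta^*_S$ of $\tilde\epsilon$ that attains $\sup_{\theta}\mathbb E_\theta\big[\max_{i\in S}\{\nu_i+\tilde\epsilon_i\}\big]$ over all joint laws $\theta$ with marginals $F_1,\dots,F_n$, and $p_{i,S}=\mathbb P_{\theta^*_S}\big(i=\arg\max_{j\in S}\{\nu_j+\tilde\epsilon_j\}\big)$ for all $i\in S$. - $\mathcal P_{\rm REG}(\mathcal S)$ is the set of choice probability collections over $\mathcal S$ with $p_{i,S}\ge p_{i,T}$ whenever $S,T\in\mathcal S$, $S\subseteq T$ and $i\in S$. The collection $\mathcal S$ is nested if it is totally ordered by inclusion, and laminar if any two of its members are disjoint or related by inclusion. **Theorem.** (a) If $n=2$, then $\mathcal P_{\rm RUM}(\mathcal S)=\mathcal P_{\rm MDM}(\mathcal S)$ for every $\mathcal S$. If $n=3$, then $\mathcal P_{\rm MDM}(\mathcal S)\subseteq\mathcal P_{\rm RUM}(\mathcal S)$ for every $\mathcal S$, and the inclusion is strict for some $\mathcal S$. For every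 $n\ge 4$, $\mathcal P_{\rm MDM}(\mathcal S)\cap\mathcal P_{\rm RUM}(\mathcal S)\ne\emptyset$ for every $\mathcal S$, and there is a collection $\mathcal S$ such that $\mathcal P_{\rm MDM}(\mathcal S)\not\subseteq\mathcal P_{\rm RUM}(\mathcal S)$ and $\mathcal P_{\rm RUM}(\mathcal S)\not\subseteq\mathcal P_{\rm MDM}(\mathcal S)$. (b) For every $n$ and every $\mathcal S$ that is nested or laminar, $\mathcal P_{\rm RUM}(\mathcal S)=\overline{\mathcal P_{\rm MDM}(\mathcal S)}=\mathcal P_{\rm REG}(\mathcal S)$. -/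

import Mathlib

open MeasureTheory

namespace ChoiceModels

/-- An assortment over the products `1, …, n` is a nonempty set of products. -/
abbrev Assortment (n : ℕ) : Type := {S : Finset (Fin n) // S.Nonempty}

/-- Real vectors `(p_{i,S} : S ∈ 𝒮, i ∈ S)`, indexed by the product-assortment pairs of the
collection `𝒮`; the topology is the usual one of a finite-dimensional real space. -/
abbrev ChoiceData {n : ℕ} (𝒮 : Set (Assortment n)) : Type :=
  (S : 𝒮) → {i : Fin n // i ∈ S.1.1} → ℝ

/-- The event, in the space of the noise vectors `ε`, that `i` is the (unique) product of `S`
with the largest utility `ν i + ε i`. -/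
def argmaxEvent {n : ℕ} (ν : Fin n → ℝ) (S : Assortment n) (i : Fin n) : Set (Fin n → ℝ) :=
  {ε | i ∈ S.1 ∧ ∀ j ∈ S.1, j ≠ i → ν j + ε j < ν i + ε i}

/-- The choice probabilities over `𝒮` that are representable by the random utility model: some
deterministic utilities `ν` and some joint law `θ` of the noise, with ties of probability zero. -/
def rumSet {n : ℕ} (𝒮 : Set (Assortment n)) : Set (ChoiceData 𝒮) :=
  {p | ∃ (ν : Fin n → ℝ) (θ : Measure (Fin n → ℝ)), IsProbabilityMeasure θ ∧
    (∀ i j : Fin n, i ≠ j → θ {ε | ν i + ε i = ν j + ε j} = 0) ∧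
    ∀ (S : 𝒮) (i : {i : Fin n // i ∈ S.1.1}), p S i = θ.real (argmaxEvent ν S.1 i.1)}

/-- The admissible marginal laws of the marginal distribution model: absolutely continuous
probability laws on `ℝ` with finite mean whose distribution function is strictly increasing on
the support. -/
structure IsAdmissibleMarginal (μ : Measure ℝ) : Prop where
  isProbabilityMeasure : IsProbabilityMeasure μ
  absolutelyContinuous : μ ≪ volume
  strictMonoOn_cdf : StrictMonoOn (ProbabilityTheory.cdf μ) μ.support
  integrable_id : Integrable (fun x : ℝ => x) μ

/-- The joint laws of the noise vector with the given marginal laws. -/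
def jointLaws {n : ℕ} (F : Fin n → Measure ℝ) : Set (Measure (Fin n → ℝ)) :=
  {θ | IsProbabilityMeasure θ ∧ ∀ i, θ.map (fun ε => ε i) = F i}

/-- The expected maximal utility over the assortment `S` under the joint law `θ`. -/
noncomputable def expectedMaxUtility {n : ℕ} (ν : Fin n → ℝ) (S : Assortment n)
    (θ : Measure (Fin n → ℝ)) : ℝ :=
  ∫ ε, S.1.sup' S.2 (fun i => ν i + ε i) ∂θ

/-- The choice probabilities over `𝒮` that are representable by the marginal distribution model:
for some deterministic utilities `ν` and some admissible marginals `F`, common to all assortments,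
the choice probabilities of each `S ∈ 𝒮` are those under a joint law which maximizes the
expected maximal utility over `S` among all the joint laws with the marginals `F`. -/
def mdmSet {n : ℕ} (𝒮 : Set (Assortment n)) : Set (ChoiceData 𝒮) :=
  {p | ∃ (ν : Fin n → ℝ) (F : Fin n → Measure ℝ), (∀ i, IsAdmissibleMarginal (F i)) ∧
    ∀ S : 𝒮, ∃ θ ∈ jointLaws F, IsMaxOn (expectedMaxUtility ν S.1) (jointLaws F) θ ∧
      ∀ i : {i : Fin n // i ∈ S.1.1}, p S i = θ.real (argmaxEvent ν S.1 i.1)}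

/-- The regular choice probabilities over `𝒮`: probability vectors on the assortments of `𝒮` for
which the probability of choosing a product does not increase when the assortment is enlarged. -/
def regSet {n : ℕ} (𝒮 : Set (Assortment n)) : Set (ChoiceData 𝒮) :=
  {p | (∀ S i, 0 ≤ p S i) ∧ (∀ S, ∑ i, p S i = 1) ∧
    ∀ (S T : 𝒮) (h : S.1.1 ⊆ T.1.1) (i : {i : Fin n // i ∈ S.1.1}), p T ⟨i.1, h i.2⟩ ≤ p S i}

/-- A nested collection: its assortments form a chain under inclusion. -/
def IsNested {n : ℕ} (𝒮 : Set (Assortment n)) : Prop :=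
  ∀ S ∈ 𝒮, ∀ T ∈ 𝒮, S.1 ⊆ T.1 ∨ T.1 ⊆ S.1

/-- A laminar collection: any two of its assortments are disjoint or related by inclusion. -/
def IsLaminar {n : ℕ} (𝒮 : Set (Assortment n)) : Prop :=
  ∀ S ∈ 𝒮, ∀ T ∈ 𝒮, S.1 ⊆ T.1 ∨ T.1 ⊆ S.1 ∨ Disjoint S.1 T.1

end ChoiceModels

/-! For fixed marginals and any `t`, the number `t + ∑ i ∈ S, E (ν i + ε i - t)⁺` bounds the
expected maximum over `S` under every coupling. If the tails `P (ν i + ε i > t)` sum to one over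
`S`, a mixture of conditioned product laws is a coupling in which almost surely exactly one product
of `S` exceeds `t`. It attains the bound, and every optimal coupling then has these tails as its
choice probabilities (`real_argmaxEvent_of_isMaxOn`). The marginal model thus amounts to one
threshold per non-singleton assortment, read through tail functions common to all assortments.
Monotonicity of the tails gives regularity; their injectivity where they lie in `(0, 1)` gives
`eq_of_mem_mdmSet`. Conversely, `stepLaw` realizes any table of tails that falls strictly from one
to zero.

Random utility is regular because argmax events shrink as assortments grow. On a laminar family the
converse holds: passing from large assortments to small ones, one builds a random choice that keeps
the choice from a larger assortment while it is available (`exists_consistent_choice`), and such a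
choice is induced by a random ranking. On the same family, thresholds depending only on the size of
the assortment represent every regular point after a perturbation towards uniform choice; hence the
closure.

Two products always form a laminar family, and uniform marginals represent its regular points
without perturbation. For three products, regular data on all assortments is an explicit mixture of
the six rankings. A ranking mixed with its reverse violates `eq_of_mem_mdmSet`, and a table of tails
violates the supermodularity `add_le_add_of_mem_rumSet`, so neither model contains the other from
four products on. -/

namespace ChoiceModels

open Set Filter Topology

/-! ### Tails of admissible laws -/

section Marginals

variable {μ : Measure ℝ}

theorem real_Ioi_eq_one_sub_cdf [IsProbabilityMeasure μ] (t : ℝ) :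
    μ.real (Ioi t) = 1 - ProbabilityTheory.cdf μ t := by
  rw [ProbabilityTheory.cdf_eq_real, ← compl_Iic, probReal_compl_eq_one_sub measurableSet_Iic]

theorem real_Ioi_antitone [IsFiniteMeasure μ] : Antitone fun t => μ.real (Ioi t) :=
  fun _ _ h => measureReal_mono (Ioi_subset_Ioi h)

theorem continuous_cdf [IsProbabilityMeasure μ] [NullSingletonClass μ] :
    Continuous (ProbabilityTheory.cdf μ) := by
  refine continuous_iff_continuousAt.2 fun a => ?_
  have hm := (ProbabilityTheory.cdf μ).mono
  rw [hm.continuousAt_iff_leftLim_eq_rightLim, StieltjesFunction.rightLim_eq]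
  refine le_antisymm (hm.leftLim_le le_rfl) ?_
  have h := (ProbabilityTheory.cdf μ).measure_singleton a
  rw [ProbabilityTheory.measure_cdf, measure_singleton] at h
  simpa using h.symm

/-- The tail function of an admissible law is injective where it takes values in `(0, 1)`. -/
theorem IsAdmissibleMarginal.eq_of_real_Ioi_eq (hμ : IsAdmissibleMarginal μ) {s t : ℝ}
    (hst : μ.real (Ioi s) = μ.real (Ioi t)) (h0 : 0 < μ.real (Ioi s))
    (h1 : μ.real (Ioi s) < 1) : s = t := by
  have := hμ.isProbabilityMeasure
  wlog hlt : s < t generalizing s t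
  · rcases lt_trichotomy s t with h | h | h
    · exact absurd h hlt
    · exact h
    · exact (this hst.symm (hst ▸ h0) (hst ▸ h1) h).symm
  have hna : NullSingletonClass μ := ⟨fun x => hμ.absolutelyContinuous (measure_singleton x)⟩
  have hpos : 0 < μ (Ioi t) := by
    have := hst ▸ h0
    exact pos_iff_ne_zero.2 fun h => by simp [measureReal_def, h] at this
  have hneg : 0 < μ (Iic s) := by
    have : 0 < μ.real (Iic s) := by
      rw [← ProbabilityTheory.cdf_eq_real]
      rw [real_Ioi_eq_one_sub_cdf] at h1
      linarith
    exact pos_iff_ne_zero.2 fun h => by simp [measureReal_def, h] at this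
  obtain ⟨x₀, hx₀, hx₀'⟩ := Measure.nonempty_inter_support_of_pos hneg
  obtain ⟨y₀, hy₀, hy₀'⟩ := Measure.nonempty_inter_support_of_pos hpos
  have hclosed : IsClosed μ.support := Measure.isClosed_support
  -- The last support point up to `s` and the first one from `t` on. Between them the support meets
  -- only `(s, t]`, which is null, so the cdf cannot increase from one to the other.
  have hx := (hclosed.inter isClosed_Iic).csSup_mem ⟨x₀, hx₀', hx₀⟩ ⟨s, fun z hz => hz.2⟩
  have hy := (hclosed.inter isClosed_Ici).csInf_mem ⟨y₀, hy₀', (show t ≤ y₀ from le_of_lt hy₀)⟩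
    ⟨t, fun z hz => hz.2⟩
  set x := sSup (μ.support ∩ Iic s) with hxdef
  set y := sInf (μ.support ∩ Ici t) with hydef
  have hxy : x < y := lt_of_le_of_lt hx.2 (lt_of_lt_of_le hlt hy.2)
  have hcdf := hμ.strictMonoOn_cdf hx.1 hy.1 hxy
  have hsub : Ioc x y ⊆ μ.supportᶜ ∪ Ioc s t ∪ {y} := by
    intro z hz
    by_cases hz1 : z = y
    · exact Or.inr hz1
    · refine Or.inl ?_
      by_cases hz2 : z ∈ Ioc s t
      · exact Or.inr hz2
      · refine Or.inl fun hzs => ?_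
        rcases le_or_gt z s with h | h
        · exact absurd (le_csSup ⟨s, fun w hw => hw.2⟩ (show z ∈ μ.support ∩ Iic s from ⟨hzs, h⟩))
            (not_le.2 hz.1)
        · have htz : t < z := by
            by_contra hc
            exact hz2 ⟨h, not_lt.1 hc⟩
          have := csInf_le ⟨t, fun w hw => hw.2⟩ (show z ∈ μ.support ∩ Ici t from ⟨hzs, htz.le⟩)
          exact hz1 (le_antisymm hz.2 this)
  have hIoc : μ (Ioc s t) = 0 := by
    have h := measureReal_sdiff (μ := μ) (Ioi_subset_Ioi hlt.le) measurableSet_Ioi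
    rw [Ioi_sdiff_Ioi, hst, sub_self] at h
    exact (measureReal_eq_zero_iff).1 h
  have hnull : μ (Ioc x y) = 0 := by
    refine measure_mono_null hsub ?_
    rw [measure_union_null_iff, measure_union_null_iff]
    exact ⟨⟨Measure.measure_compl_support, hIoc⟩, measure_singleton y⟩
  have h := measureReal_sdiff (μ := μ) (Iic_subset_Iic.2 hxy.le) measurableSet_Iic
  rw [Iic_sdiff_Iic, measureReal_def, hnull] at h
  rw [ProbabilityTheory.cdf_eq_real, ProbabilityTheory.cdf_eq_real] at hcdf
  simp at h
  linarith

end Marginals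

/-! ### Duality and the optimal coupling for one assortment -/

section Coupling

variable {n : ℕ} {ν : Fin n → ℝ} {F : Fin n → Measure ℝ}

theorem measurableSet_argmaxEvent (ν : Fin n → ℝ) (S : Assortment n) (i : Fin n) :
    MeasurableSet (argmaxEvent ν S i) := by
  have : argmaxEvent ν S i = {_ε | i ∈ S.1} ∩
      ⋂ j ∈ S.1, {ε | j ≠ i → ν j + ε j < ν i + ε i} := by
    ext ε; simp [argmaxEvent]
  rw [this]
  refine (MeasurableSet.const _).inter (Finset.measurableSet_biInter _ fun j _ => ?_)
  by_cases h : j = i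
  · simp [h]
  · simp only [ne_eq, h, not_false_eq_true, forall_true_left]
    exact measurableSet_lt (by fun_prop) (by fun_prop)

theorem pairwiseDisjoint_argmaxEvent (ν : Fin n → ℝ) (S : Assortment n) (s : Set (Fin n)) :
    s.PairwiseDisjoint (argmaxEvent ν S) := by
  intro i _ j _ hij
  refine Set.disjoint_left.2 fun ε hi hj => ?_
  exact lt_asymm (hi.2 j hj.1 hij.symm) (hj.2 i hi.1 hij)

theorem sum_real_argmaxEvent_le_one (ν : Fin n → ℝ) (S : Assortment n)
    (θ : Measure (Fin n → ℝ)) [IsProbabilityMeasure θ] :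
    ∑ i ∈ S.1, θ.real (argmaxEvent ν S i) ≤ 1 := by
  rw [← measureReal_biUnion_finset (pairwiseDisjoint_argmaxEvent ν S _)
    fun i _ => measurableSet_argmaxEvent ν S i]
  exact measureReal_le_one

/-- The choice probability, for the threshold `t`, of a product with marginal law `F i`. -/
noncomputable def excess (ν : Fin n → ℝ) (F : Fin n → Measure ℝ) (t : ℝ) (i : Fin n) : ℝ :=
  (F i).real (Ioi (t - ν i))

theorem integrable_coord (hF : ∀ i, IsAdmissibleMarginal (F i)) {θ : Measure (Fin n → ℝ)}
    (hθ : θ ∈ jointLaws F) (i : Fin n) : Integrable (fun ε : Fin n → ℝ => ε i) θ := by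
  have h := (hF i).integrable_id
  rw [← hθ.2 i] at h
  exact (integrable_map_measure (f := fun ε : Fin n → ℝ => ε i) (g := fun x => x)
    (by fun_prop) (measurable_pi_apply i).aemeasurable).1 h

theorem integrable_max (hF : ∀ i, IsAdmissibleMarginal (F i)) {θ : Measure (Fin n → ℝ)}
    (hθ : θ ∈ jointLaws F) (S : Assortment n) :
    Integrable (fun ε : Fin n → ℝ => S.1.sup' S.2 (fun i => ν i + ε i)) θ := by
  have := hθ.1
  have h : Integrable (S.1.sup' S.2 (fun i (ε : Fin n → ℝ) => ν i + ε i)) θ := by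
    refine Finset.sup'_induction (p := fun f => Integrable f θ) S.2 _
      (fun f hf g hg => Integrable.sup hf hg) fun i _ => ?_
    exact (integrable_const _).add (integrable_coord hF hθ i)
  refine h.congr (Eventually.of_forall fun ε => ?_)
  simp [Finset.sup'_apply]

/-- The dual bound on the expected maximal utility for the threshold `t`. -/
noncomputable def dualBound (ν : Fin n → ℝ) (F : Fin n → Measure ℝ) (S : Assortment n)
    (t : ℝ) : ℝ :=
  t + ∑ i ∈ S.1, ∫ x, max (ν i + x - t) 0 ∂(F i)

/-- The difference between the dual bound and the maximal utility, for a noise vector. -/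
noncomputable def dualGap (ν : Fin n → ℝ) (S : Assortment n) (t : ℝ) (ε : Fin n → ℝ) : ℝ :=
  t + ∑ i ∈ S.1, max (ν i + ε i - t) 0 - S.1.sup' S.2 (fun i => ν i + ε i)

theorem dualGap_nonneg (ν : Fin n → ℝ) (S : Assortment n) (t : ℝ) (ε : Fin n → ℝ) :
    0 ≤ dualGap ν S t ε := by
  refine sub_nonneg.2 (Finset.sup'_le _ _ fun i hi => ?_)
  have h := Finset.single_le_sum (f := fun i => max (ν i + ε i - t) 0)
    (fun j _ => le_max_right _ _) hi
  have h' := le_max_left (ν i + ε i - t) 0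
  linarith

theorem integrable_dualGap_and_integral (hF : ∀ i, IsAdmissibleMarginal (F i))
    {θ : Measure (Fin n → ℝ)} (hθ : θ ∈ jointLaws F) (S : Assortment n) (t : ℝ) :
    Integrable (dualGap ν S t) θ ∧
      ∫ ε, dualGap ν S t ε ∂θ = dualBound ν F S t - expectedMaxUtility ν S θ := by
  have := hθ.1
  have hpos (i : Fin n) : Integrable (fun ε : Fin n → ℝ => max (ν i + ε i - t) 0) θ :=
    ((((integrable_const _).add (integrable_coord hF hθ i)).sub (integrable_const _))).pos_part
  have hsum : Integrable (fun ε : Fin n → ℝ => ∑ i ∈ S.1, max (ν i + ε i - t) 0) θ :=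
    integrable_finsetSum _ fun i _ => hpos i
  have h1 : Integrable (fun ε : Fin n → ℝ => t + ∑ i ∈ S.1, max (ν i + ε i - t) 0) θ :=
    (integrable_const _).add hsum
  refine ⟨h1.sub (integrable_max hF hθ S), ?_⟩
  unfold dualGap
  rw [integral_sub h1 (integrable_max hF hθ S), integral_add (integrable_const _) hsum,
    integral_finsetSum _ fun i _ => hpos i]
  unfold dualBound expectedMaxUtility
  have hmap (i : Fin n) : ∫ ε : Fin n → ℝ, max (ν i + ε i - t) 0 ∂θ
      = ∫ x, max (ν i + x - t) 0 ∂(F i) := by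
    rw [← hθ.2 i, integral_map (measurable_pi_apply i).aemeasurable]
    exact (by fun_prop : Continuous fun x : ℝ => max (ν i + x - t) 0).aestronglyMeasurable
  simp [hmap]

theorem expectedMaxUtility_le_dualBound (hF : ∀ i, IsAdmissibleMarginal (F i))
    {θ : Measure (Fin n → ℝ)} (hθ : θ ∈ jointLaws F) (S : Assortment n) (t : ℝ) :
    expectedMaxUtility ν S θ ≤ dualBound ν F S t := by
  have h := (integrable_dualGap_and_integral (ν := ν) hF hθ S t).2
  have h' : 0 ≤ ∫ ε, dualGap ν S t ε ∂θ := integral_nonneg fun ε => dualGap_nonneg ν S t ε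
  linarith

theorem dualGap_eq_zero_of_unique {S : Assortment n} {t : ℝ} {ε : Fin n → ℝ} {i : Fin n}
    (hi : i ∈ S.1) (hit : t < ν i + ε i) (hj : ∀ j ∈ S.1, j ≠ i → ν j + ε j ≤ t) :
    dualGap ν S t ε = 0 := by
  have h1 : S.1.sup' S.2 (fun i => ν i + ε i) = ν i + ε i := by
    refine le_antisymm (Finset.sup'_le _ _ fun j hjS => ?_)
      (Finset.le_sup' (fun i => ν i + ε i) hi)
    by_cases h : j = i
    · rw [h]
    · exact (hj j hjS h).trans hit.le
  have h2 : ∑ i ∈ S.1, max (ν i + ε i - t) 0 = ν i + ε i - t := by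
    rw [Finset.sum_eq_single_of_mem i hi, max_eq_left (by linarith)]
    intro j hjS h
    exact max_eq_right (by linarith [hj j hjS h])
  unfold dualGap
  rw [h1, h2]; ring

/-- The maximal product's excess over `t` already pays for the maximum, so a second product above
`t` would make the gap strictly positive. -/
theorem not_both_of_dualGap_eq_zero {S : Assortment n} {t : ℝ} {ε : Fin n → ℝ}
    (h : dualGap ν S t ε = 0) {i j : Fin n} (hi : i ∈ S.1) (hj : j ∈ S.1) (hij : j ≠ i)
    (hit : t < ν i + ε i) : ν j + ε j ≤ t := by
  by_contra hjt
  push Not at hjt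
  obtain ⟨k, hk, hkmax⟩ := S.1.exists_mem_eq_sup' S.2 (fun i => ν i + ε i)
  obtain ⟨l, hl, hlk, hlt⟩ : ∃ l ∈ S.1, l ≠ k ∧ t < ν l + ε l := by
    by_cases hik : i = k
    · exact ⟨j, hj, by rwa [← hik], hjt⟩
    · exact ⟨i, hi, hik, hit⟩
  have hsum : max (ν l + ε l - t) 0 + max (ν k + ε k - t) 0 ≤
      ∑ i ∈ S.1, max (ν i + ε i - t) 0 := by
    rw [← Finset.sum_pair (f := fun i => max (ν i + ε i - t) 0) hlk]
    refine Finset.sum_le_sum_of_subset_of_nonneg ?_ fun _ _ _ => le_max_right _ _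
    intro x hx
    rcases Finset.mem_insert.1 hx with rfl | hx
    · exact hl
    · rwa [Finset.mem_singleton.1 hx]
  unfold dualGap at h
  rw [hkmax] at h
  have h1 := le_max_left (ν l + ε l - t) 0
  have h2 := le_max_left (ν k + ε k - t) 0
  linarith

/-- With zero gap, a product above `t` is alone there and so is the argmax. Each tail is thus at
most the choice probability; the tails sum to one and the choice probabilities to at most one, so
equality holds termwise. -/
theorem real_argmaxEvent_of_dualGap {S : Assortment n} {t : ℝ} (ht : ∑ i ∈ S.1, excess ν F t i = 1)
    {θ : Measure (Fin n → ℝ)} (hθ : θ ∈ jointLaws F) (hgap : ∀ᵐ ε ∂θ, dualGap ν S t ε = 0)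
    {i : Fin n} (hi : i ∈ S.1) : θ.real (argmaxEvent ν S i) = excess ν F t i := by
  have := hθ.1
  have hle : ∀ j ∈ S.1, excess ν F t j ≤ θ.real (argmaxEvent ν S j) := by
    intro j hj
    have h1 : excess ν F t j = θ.real {ε | t - ν j < ε j} := by
      unfold excess
      rw [← hθ.2 j, map_measureReal_apply (by fun_prop) measurableSet_Ioi]
      rfl
    rw [h1]
    refine ENNReal.toReal_mono (measure_ne_top _ _) (measure_mono_ae ?_)
    filter_upwards [hgap] with ε hε hjt
    have hjt : t < ν j + ε j := by
      have : t - ν j < ε j := hjt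
      linarith
    exact ⟨hj, fun k hk hkj =>
      (not_both_of_dualGap_eq_zero hε hj hk hkj hjt).trans_lt hjt⟩
  have hsum := sum_real_argmaxEvent_le_one ν S θ
  refine ((Finset.sum_eq_sum_iff_of_le hle).1 ?_ i hi).symm
  exact le_antisymm (Finset.sum_le_sum hle) (by rw [ht]; exact hsum)

/-- The coupling in which exactly one product of `S` exceeds the threshold. -/
noncomputable def thresholdCoupling (ν : Fin n → ℝ) (F : Fin n → Measure ℝ) (S : Assortment n)
    (t : ℝ) : Measure (Fin n → ℝ) :=
  ∑ i ∈ S.1, F i (Ioi (t - ν i)) • Measure.pi fun j =>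
    if j = i then ProbabilityTheory.cond (F j) (Ioi (t - ν j))
    else if j ∈ S.1 then ProbabilityTheory.cond (F j) (Iic (t - ν j)) else F j

theorem smul_cond {μ : Measure ℝ} [IsFiniteMeasure μ] (s : Set ℝ) :
    μ s • ProbabilityTheory.cond μ s = μ.restrict s := by
  by_cases h : μ s = 0
  · rw [h, zero_smul, Measure.restrict_eq_zero.2 h]
  · rw [ProbabilityTheory.cond, smul_smul, ENNReal.mul_inv_cancel h (measure_ne_top _ _), one_smul]

theorem sum_measure_Ioi (hF : ∀ i, IsAdmissibleMarginal (F i)) {S : Assortment n} {t : ℝ}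
    (ht : ∑ i ∈ S.1, excess ν F t i = 1) : ∑ i ∈ S.1, F i (Ioi (t - ν i)) = 1 := by
  have (i : Fin n) := (hF i).isProbabilityMeasure
  rw [← ENNReal.toReal_eq_one_iff, ENNReal.toReal_sum fun i _ => measure_ne_top _ _]
  exact ht

theorem isProbabilityMeasure_factor (hF : ∀ i, IsAdmissibleMarginal (F i)) {S : Assortment n}
    {t : ℝ} (ht : ∑ i ∈ S.1, excess ν F t i = 1) {i : Fin n} (hi : i ∈ S.1)
    (h0 : F i (Ioi (t - ν i)) ≠ 0) (j : Fin n) :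
    IsProbabilityMeasure (if j = i then ProbabilityTheory.cond (F j) (Ioi (t - ν j))
      else if j ∈ S.1 then ProbabilityTheory.cond (F j) (Iic (t - ν j)) else F j) := by
  have (i : Fin n) := (hF i).isProbabilityMeasure
  split_ifs with h1 h2
  · subst h1
    exact ProbabilityTheory.cond_isProbabilityMeasure h0
  · refine ProbabilityTheory.cond_isProbabilityMeasure fun hc => ?_
    -- Conditioning on a null lower part would put the whole unit of tail mass on `j` and leave none
    -- for `i`.
    have hj1 : F j (Ioi (t - ν j)) = 1 := by
      rw [← compl_Iic, prob_compl_eq_one_sub measurableSet_Iic, hc, tsub_zero]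
    have hsum := sum_measure_Ioi hF ht
    have hle : F j (Ioi (t - ν j)) + F i (Ioi (t - ν i)) ≤ 1 := by
      rw [← hsum, ← Finset.sum_pair (f := fun i => F i (Ioi (t - ν i))) h1]
      refine Finset.sum_le_sum_of_subset ?_
      intro x hx
      rcases Finset.mem_insert.1 hx with rfl | hx
      · exact h2
      · rwa [Finset.mem_singleton.1 hx]
    rw [hj1] at hle
    have := ENNReal.le_sub_of_add_le_left ENNReal.one_ne_top hle
    simp at this
    exact h0 this
  · infer_instance

theorem thresholdCoupling_mem_jointLaws (hF : ∀ i, IsAdmissibleMarginal (F i))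
    {S : Assortment n} {t : ℝ} (ht : ∑ i ∈ S.1, excess ν F t i = 1) :
    thresholdCoupling ν F S t ∈ jointLaws F := by
  have (i : Fin n) := (hF i).isProbabilityMeasure
  have hsum := sum_measure_Ioi hF ht
  constructor
  · constructor
    unfold thresholdCoupling
    rw [Measure.finsetSum_apply, ← hsum]
    refine Finset.sum_congr rfl fun i hi => ?_
    by_cases h0 : F i (Ioi (t - ν i)) = 0
    · simp [h0]
    · have := isProbabilityMeasure_factor hF ht hi h0
      simp
  · intro j
    unfold thresholdCoupling
    rw [Measure.map_finset_sum (measurable_pi_apply j).aemeasurable]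
    have hterm : ∀ i ∈ S.1, (F i (Ioi (t - ν i)) • Measure.pi fun j =>
        if j = i then ProbabilityTheory.cond (F j) (Ioi (t - ν j))
        else if j ∈ S.1 then ProbabilityTheory.cond (F j) (Iic (t - ν j)) else F j).map
          (fun ε : Fin n → ℝ => ε j) =
        F i (Ioi (t - ν i)) • (if j = i then ProbabilityTheory.cond (F j) (Ioi (t - ν j))
        else if j ∈ S.1 then ProbabilityTheory.cond (F j) (Iic (t - ν j)) else F j) := by
      intro i hi
      rw [Measure.map_smul]
      by_cases h0 : F i (Ioi (t - ν i)) = 0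
      · simp [h0]
      · have := isProbabilityMeasure_factor hF ht hi h0
        congr 1
        exact (measurePreserving_eval _ j).map_eq
    rw [Finset.sum_congr rfl hterm]
    by_cases hj : j ∈ S.1
    · rw [← Finset.add_sum_erase _ _ hj]
      -- The components in which `j` stays below the threshold have total weight `F j (Iic (t - ν
      -- j))`, exactly what reassembles `F j` from its two conditional laws.
      have hrest : ∑ i ∈ S.1.erase j, F i (Ioi (t - ν i)) = F j (Iic (t - ν j)) := by
        rw [← Finset.add_sum_erase _ _ hj] at hsum
        rw [← compl_Ioi, prob_compl_eq_one_sub measurableSet_Ioi, ← hsum,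
          ENNReal.add_sub_cancel_left (measure_ne_top _ _)]
      have hcongr : ∀ i ∈ S.1.erase j, F i (Ioi (t - ν i)) •
          (if j = i then ProbabilityTheory.cond (F j) (Ioi (t - ν j))
          else if j ∈ S.1 then ProbabilityTheory.cond (F j) (Iic (t - ν j)) else F j) =
          F i (Ioi (t - ν i)) • ProbabilityTheory.cond (F j) (Iic (t - ν j)) := by
        intro i hi
        rw [if_neg (Finset.ne_of_mem_erase hi).symm, if_pos hj]
      rw [Finset.sum_congr rfl hcongr, ← Finset.sum_smul, hrest, if_pos rfl, smul_cond, smul_cond,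
        ← compl_Ioi, Measure.restrict_add_restrict_compl measurableSet_Ioi]
    · have hcongr : ∀ i ∈ S.1, F i (Ioi (t - ν i)) •
          (if j = i then ProbabilityTheory.cond (F j) (Ioi (t - ν j))
          else if j ∈ S.1 then ProbabilityTheory.cond (F j) (Iic (t - ν j)) else F j) =
          F i (Ioi (t - ν i)) • F j := by
        intro i hi
        rw [if_neg (by rintro rfl; exact hj hi), if_neg hj]
      rw [Finset.sum_congr rfl hcongr, ← Finset.sum_smul, hsum, one_smul]

theorem ae_cond_mem {μ : Measure ℝ} {s : Set ℝ} (hs : MeasurableSet s) :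
    ∀ᵐ x ∂(ProbabilityTheory.cond μ s), x ∈ s :=
  Measure.ae_smul_measure (ae_restrict_mem hs) _

theorem dualGap_thresholdCoupling (hF : ∀ i, IsAdmissibleMarginal (F i))
    {S : Assortment n} {t : ℝ} (ht : ∑ i ∈ S.1, excess ν F t i = 1) :
    ∀ᵐ ε ∂(thresholdCoupling ν F S t), dualGap ν S t ε = 0 := by
  unfold thresholdCoupling
  rw [ae_finsetSum_measure_iff]
  intro i hi
  by_cases h0 : F i (Ioi (t - ν i)) = 0
  · simp [h0]
  refine Measure.ae_smul_measure ?_ _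
  have := isProbabilityMeasure_factor hF ht hi h0
  have hcoord (j : Fin n) := (measurePreserving_eval (fun j =>
    if j = i then ProbabilityTheory.cond (F j) (Ioi (t - ν j))
    else if j ∈ S.1 then ProbabilityTheory.cond (F j) (Iic (t - ν j)) else F j)
      j).quasiMeasurePreserving
  have hall : ∀ᵐ ε ∂(Measure.pi fun j =>
      if j = i then ProbabilityTheory.cond (F j) (Ioi (t - ν j))
      else if j ∈ S.1 then ProbabilityTheory.cond (F j) (Iic (t - ν j)) else F j),
      ∀ j : Fin n, (j = i → ε j ∈ Ioi (t - ν j)) ∧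
        (j ≠ i → j ∈ S.1 → ε j ∈ Iic (t - ν j)) := by
    refine ae_all_iff.2 fun j => ?_
    refine (hcoord j).ae (p := fun x => (j = i → x ∈ Ioi (t - ν j)) ∧
        (j ≠ i → j ∈ S.1 → x ∈ Iic (t - ν j))) ?_
    by_cases h1 : j = i
    · simp only [h1, ↓reduceIte, forall_true_left, ne_eq, not_true_eq_false, false_imp_iff,
        and_true]
      exact ae_cond_mem measurableSet_Ioi
    · by_cases h2 : j ∈ S.1
      · simp only [h1, h2, ↓reduceIte, forall_true_left, ne_eq, not_false_eq_true, false_imp_iff,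
          true_and]
        exact ae_cond_mem measurableSet_Iic
      · simp [h1, h2]
  filter_upwards [hall] with ε hε
  refine dualGap_eq_zero_of_unique hi ?_ fun j hj hji => ?_
  · have : t - ν i < ε i := (hε i).1 rfl
    linarith
  · have : ε j ≤ t - ν j := (hε j).2 hji hj
    linarith

theorem expectedMaxUtility_thresholdCoupling (hF : ∀ i, IsAdmissibleMarginal (F i))
    {S : Assortment n} {t : ℝ} (ht : ∑ i ∈ S.1, excess ν F t i = 1) :
    expectedMaxUtility ν S (thresholdCoupling ν F S t) = dualBound ν F S t := by
  have h := (integrable_dualGap_and_integral (ν := ν) hF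
    (thresholdCoupling_mem_jointLaws hF ht) S t).2
  rw [integral_congr_ae (dualGap_thresholdCoupling hF ht), integral_zero] at h
  linarith

theorem isMaxOn_thresholdCoupling (hF : ∀ i, IsAdmissibleMarginal (F i))
    {S : Assortment n} {t : ℝ} (ht : ∑ i ∈ S.1, excess ν F t i = 1) :
    IsMaxOn (expectedMaxUtility ν S) (jointLaws F) (thresholdCoupling ν F S t) := by
  refine isMaxOn_iff.2 fun θ hθ => ?_
  rw [expectedMaxUtility_thresholdCoupling hF ht]
  exact expectedMaxUtility_le_dualBound hF hθ S t

/-- Every optimal joint law has the choice probabilities given by the threshold. -/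
theorem real_argmaxEvent_of_isMaxOn (hF : ∀ i, IsAdmissibleMarginal (F i))
    {S : Assortment n} {t : ℝ} (ht : ∑ i ∈ S.1, excess ν F t i = 1)
    {θ : Measure (Fin n → ℝ)} (hθ : θ ∈ jointLaws F)
    (hmax : IsMaxOn (expectedMaxUtility ν S) (jointLaws F) θ) {i : Fin n} (hi : i ∈ S.1) :
    θ.real (argmaxEvent ν S i) = excess ν F t i := by
  refine real_argmaxEvent_of_dualGap ht hθ ?_ hi
  have h := integrable_dualGap_and_integral (ν := ν) hF hθ S t
  have h1 := isMaxOn_iff.1 hmax _ (thresholdCoupling_mem_jointLaws hF ht)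
  rw [expectedMaxUtility_thresholdCoupling hF ht] at h1
  have h2 : ∫ ε, dualGap ν S t ε ∂θ = 0 :=
    le_antisymm (by rw [h.2]; linarith) (integral_nonneg fun ε => dualGap_nonneg ν S t ε)
  exact (integral_eq_zero_iff_of_nonneg (fun ε => dualGap_nonneg ν S t ε) h.1).1 h2

/-- The sum of the tails is continuous in `t` and runs from the size of `S` down to zero. For a
singleton the value one might be reached only in the limit, so singletons are treated apart. -/
theorem exists_threshold (hF : ∀ i, IsAdmissibleMarginal (F i)) (S : Assortment n)
    (hS : 1 < S.1.card) : ∃ t, ∑ i ∈ S.1, excess ν F t i = 1 := by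
  have (i : Fin n) := (hF i).isProbabilityMeasure
  have hna (i : Fin n) : NullSingletonClass (F i) :=
    ⟨fun x => (hF i).absolutelyContinuous (measure_singleton x)⟩
  have heq : (fun t => ∑ i ∈ S.1, excess ν F t i) =
      fun t => ∑ i ∈ S.1, (1 - ProbabilityTheory.cdf (F i) (t - ν i)) := by
    funext t
    exact Finset.sum_congr rfl fun i _ => real_Ioi_eq_one_sub_cdf _
  have hcont : Continuous fun t => ∑ i ∈ S.1, excess ν F t i := by
    rw [heq]
    have (i : Fin n) : Continuous (ProbabilityTheory.cdf (F i)) := continuous_cdf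
    fun_prop
  have hbot : Tendsto (fun t => ∑ i ∈ S.1, excess ν F t i) atBot (𝓝 (∑ i ∈ S.1, (1 - 0))) := by
    rw [heq]
    refine tendsto_finsetSum _ fun i _ => tendsto_const_nhds.sub ?_
    exact (ProbabilityTheory.tendsto_cdf_atBot _).comp (tendsto_atBot_add_const_right _ _ tendsto_id)
  have htop : Tendsto (fun t => ∑ i ∈ S.1, excess ν F t i) atTop (𝓝 (∑ i ∈ S.1, (1 - 1))) := by
    rw [heq]
    refine tendsto_finsetSum _ fun i _ => tendsto_const_nhds.sub ?_
    exact (ProbabilityTheory.tendsto_cdf_atTop _).comp (tendsto_atTop_add_const_right _ _ tendsto_id)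
  refine mem_range_of_exists_le_of_exists_ge hcont ?_ ?_
  · exact ((htop.eventually_lt_const (u := 1) (by simp)).exists).imp fun _ h => h.le
  · exact ((hbot.eventually_const_lt (u := 1) (by simpa using hS)).exists).imp fun _ h => h.le

end Coupling

/-! ### The marginal model in terms of thresholds -/

section Representation

variable {n : ℕ} {ν : Fin n → ℝ} {F : Fin n → Measure ℝ}

theorem pi_mem_jointLaws (hF : ∀ i, IsAdmissibleMarginal (F i)) : Measure.pi F ∈ jointLaws F := by
  have (i : Fin n) := (hF i).isProbabilityMeasure
  exact ⟨inferInstance, fun i => (measurePreserving_eval F i).map_eq⟩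

theorem expectedMaxUtility_of_eq_singleton {S : Assortment n} {i : Fin n} (hS : S.1 = {i})
    {θ : Measure (Fin n → ℝ)} (hθ : θ ∈ jointLaws F) :
    expectedMaxUtility ν S θ = ∫ x, (ν i + x) ∂(F i) := by
  obtain ⟨S, hne⟩ := S
  subst hS
  rw [← hθ.2 i, integral_map (measurable_pi_apply i).aemeasurable
    (by fun_prop : Continuous fun x : ℝ => ν i + x).aestronglyMeasurable]
  simp [expectedMaxUtility]

theorem exists_isMaxOn (hF : ∀ i, IsAdmissibleMarginal (F i)) (ν : Fin n → ℝ)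
    (S : Assortment n) :
    ∃ θ ∈ jointLaws F, IsMaxOn (expectedMaxUtility ν S) (jointLaws F) θ := by
  rcases (Nat.succ_le_of_lt S.2.card_pos).lt_or_eq with h | h
  · obtain ⟨t, ht⟩ := exists_threshold (ν := ν) hF S h
    exact ⟨_, thresholdCoupling_mem_jointLaws hF ht, isMaxOn_thresholdCoupling hF ht⟩
  · obtain ⟨i, hi⟩ := Finset.card_eq_one.1 h.symm
    refine ⟨_, pi_mem_jointLaws hF, isMaxOn_iff.2 fun θ hθ => ?_⟩
    rw [expectedMaxUtility_of_eq_singleton hi hθ,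
      expectedMaxUtility_of_eq_singleton hi (pi_mem_jointLaws hF)]

theorem real_argmaxEvent_of_card_eq_one {S : Assortment n} (hS : S.1.card = 1) {i : Fin n}
    (hi : i ∈ S.1) (θ : Measure (Fin n → ℝ)) [IsProbabilityMeasure θ] :
    θ.real (argmaxEvent ν S i) = 1 := by
  have : argmaxEvent ν S i = univ := by
    refine eq_univ_of_forall fun ε => ⟨hi, fun j hj hji => absurd ?_ hji⟩
    exact Finset.card_le_one.1 hS.le j hj i hi
  rw [this, probReal_univ]

/-- Points of the marginal distribution model from one threshold for each assortment. -/
theorem mem_mdmSet_of_thresholds {𝒮 : Set (Assortment n)} (hF : ∀ i, IsAdmissibleMarginal (F i))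
    {p : ChoiceData 𝒮} (t : 𝒮 → ℝ) (hsum : ∀ S, ∑ i, p S i = 1)
    (hp : ∀ S i, p S i = excess ν F (t S) i.1) : p ∈ mdmSet 𝒮 := by
  refine ⟨ν, F, hF, fun S => ?_⟩
  have ht : ∑ i ∈ S.1.1, excess ν F (t S) i = 1 := by
    rw [← hsum S, ← Finset.sum_coe_sort]
    exact Finset.sum_congr rfl fun i _ => (hp S i).symm
  refine ⟨_, thresholdCoupling_mem_jointLaws hF ht, isMaxOn_thresholdCoupling hF ht, fun i => ?_⟩
  rw [hp, real_argmaxEvent_of_isMaxOn hF ht (thresholdCoupling_mem_jointLaws hF ht)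
    (isMaxOn_thresholdCoupling hF ht) i.2]

/-- Points of the marginal distribution model have one threshold for each assortment with at
least two products. -/
theorem exists_thresholds_of_mem_mdmSet {𝒮 : Set (Assortment n)} {p : ChoiceData 𝒮}
    (hp : p ∈ mdmSet 𝒮) :
    ∃ (ν : Fin n → ℝ) (F : Fin n → Measure ℝ), (∀ i, IsAdmissibleMarginal (F i)) ∧
      ∀ S : 𝒮, (S.1.1.card = 1 ∧ ∀ i, p S i = 1) ∨
        ∃ t, ∑ i ∈ S.1.1, excess ν F t i = 1 ∧ ∀ i, p S i = excess ν F t i.1 := by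
  obtain ⟨ν, F, hF, h⟩ := hp
  refine ⟨ν, F, hF, fun S => ?_⟩
  obtain ⟨θ, hθ, hmax, hpS⟩ := h S
  rcases (Nat.succ_le_of_lt S.1.2.card_pos).lt_or_eq with hc | hc
  · obtain ⟨t, ht⟩ := exists_threshold (ν := ν) hF S.1 hc
    refine Or.inr ⟨t, ht, fun i => ?_⟩
    rw [hpS, real_argmaxEvent_of_isMaxOn hF ht hθ hmax i.2]
  · have := hθ.1
    exact Or.inl ⟨hc.symm, fun i => by rw [hpS, real_argmaxEvent_of_card_eq_one hc.symm i.2]⟩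

/-- The marginal distribution model on a collection extends to all the assortments. -/
theorem exists_extension_of_mem_mdmSet {𝒮 : Set (Assortment n)} {p : ChoiceData 𝒮}
    (hp : p ∈ mdmSet 𝒮) :
    ∃ q ∈ mdmSet (univ : Set (Assortment n)), ∀ S i, p S i = q ⟨S.1, mem_univ _⟩ i := by
  obtain ⟨ν, F, hF, h⟩ := hp
  choose θ hθ hmax hpS using h
  choose θ' hθ' hmax' using exists_isMaxOn hF ν
  classical
  -- The given optimal laws are kept on `𝒮`, so the extension agrees with `p` there even on
  -- assortments without a threshold.
  let η : Assortment n → Measure (Fin n → ℝ) := fun S => if h : S ∈ 𝒮 then θ ⟨S, h⟩ else θ' S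
  refine ⟨fun S i => (η S.1).real (argmaxEvent ν S.1 i.1),
    ⟨ν, F, hF, fun S => ⟨η S.1, ?_, ?_, fun i => rfl⟩⟩, fun S i => ?_⟩
  · by_cases h : S.1 ∈ 𝒮
    · simpa only [η, h, dif_pos] using hθ ⟨S.1, h⟩
    · simpa only [η, h, dif_neg, not_false_eq_true] using hθ' S.1
  · by_cases h : S.1 ∈ 𝒮
    · simpa only [η, h, dif_pos] using hmax ⟨S.1, h⟩
    · simpa only [η, h, dif_neg, not_false_eq_true] using hmax' S.1
  · simp only [η, S.2, dif_pos, hpS]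

theorem excess_antitone (hF : ∀ i, IsAdmissibleMarginal (F i)) (i : Fin n) :
    Antitone fun t => excess ν F t i := by
  have := (hF i).isProbabilityMeasure
  exact fun s t h => real_Ioi_antitone (sub_le_sub_right h _)

theorem excess_nonneg (i : Fin n) (t : ℝ) : 0 ≤ excess ν F t i := measureReal_nonneg

theorem mdmSet_subset_regSet (𝒮 : Set (Assortment n)) : mdmSet 𝒮 ⊆ regSet 𝒮 := by
  intro p hp
  obtain ⟨ν, F, hF, h⟩ := exists_thresholds_of_mem_mdmSet hp
  have hle (S : 𝒮) (i) : p S i ≤ 1 := by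
    rcases h S with ⟨-, h⟩ | ⟨t, ht, h⟩
    · exact (h i).le
    · rw [h, ← ht]
      exact Finset.single_le_sum (f := fun i => excess ν F t i) (fun j _ => excess_nonneg j t) i.2
  refine ⟨fun S i => ?_, fun S => ?_, fun S T hST i => ?_⟩
  · rcases h S with ⟨-, h⟩ | ⟨t, ht, h⟩
    · simp [h]
    · rw [h]; exact excess_nonneg _ _
  · rcases h S with ⟨hc, h⟩ | ⟨t, ht, h⟩
    · simp [h, hc]
    · rw [← ht, ← Finset.sum_coe_sort S.1.1 (excess ν F t)]
      exact Finset.sum_congr rfl fun i _ => h i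
  · rcases h S with ⟨-, hS⟩ | ⟨s, hs, hS⟩
    · rw [hS]; exact hle _ _
    rcases h T with ⟨hc, hT⟩ | ⟨t, ht, hT⟩
    · have hST' : S.1.1 = T.1.1 :=
        Finset.eq_of_subset_of_card_le hST (by rw [hc]; exact S.1.2.card_pos)
      have : S = T := Subtype.ext (Subtype.ext hST')
      subst this
      exact le_rfl
    rw [hS, hT]
    rcases le_total s t with hst | hst
    · exact excess_antitone hF i.1 hst
    · have hle : ∀ j ∈ S.1.1, excess ν F s j ≤ excess ν F t j :=
        fun j _ => excess_antitone hF j hst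
      refine ((Finset.sum_eq_sum_iff_of_le hle).1 (le_antisymm (Finset.sum_le_sum hle) ?_)
        i.1 i.2).ge
      rw [hs, ← ht]
      exact Finset.sum_le_sum_of_subset_of_nonneg hST fun j _ _ => excess_nonneg j t

/-- Two assortments which give one product the same probability in `(0, 1)` have the same
threshold, hence give every common product the same probability. -/
theorem eq_of_mem_mdmSet {𝒮 : Set (Assortment n)} {p : ChoiceData 𝒮} (hp : p ∈ mdmSet 𝒮)
    {S T : 𝒮} {i : Fin n} (hiS : i ∈ S.1.1) (hiT : i ∈ T.1.1) (h : p S ⟨i, hiS⟩ = p T ⟨i, hiT⟩)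
    (h0 : 0 < p S ⟨i, hiS⟩) (h1 : p S ⟨i, hiS⟩ < 1) {j : Fin n} (hjS : j ∈ S.1.1)
    (hjT : j ∈ T.1.1) : p S ⟨j, hjS⟩ = p T ⟨j, hjT⟩ := by
  obtain ⟨ν, F, hF, hth⟩ := exists_thresholds_of_mem_mdmSet hp
  rcases hth S with ⟨-, hS⟩ | ⟨s, hs, hS⟩
  · exact absurd (hS _) h1.ne
  rcases hth T with ⟨-, hT⟩ | ⟨t, ht, hT⟩
  · exact absurd (h.trans (hT _)) h1.ne
  rw [hS] at h h0 h1
  rw [hT] at h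
  have : s = t := sub_left_injective ((hF i).eq_of_real_Ioi_eq h h0 h1)
  rw [hS, hT, this]

end Representation

/-! ### Marginals with prescribed tails at the integers -/

section StepLaw

variable {a : ℕ → ℝ} {N : ℕ}

/-- The law on `(0, N]` with constant density `a k - a (k + 1)` on `(k, k + 1]`. -/
noncomputable def stepLaw (a : ℕ → ℝ) (N : ℕ) : Measure ℝ :=
  ∑ k ∈ Finset.range N, ENNReal.ofReal (a k - a (k + 1)) •
    volume.restrict (Ioc (k : ℝ) ((k : ℝ) + 1))

theorem stepLaw_apply {s : Set ℝ} (hs : MeasurableSet s) :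
    stepLaw a N s = ∑ k ∈ Finset.range N, ENNReal.ofReal (a k - a (k + 1)) *
      volume (s ∩ Ioc (k : ℝ) ((k : ℝ) + 1)) := by
  simp [stepLaw, Measure.finsetSum_apply, Measure.restrict_apply hs]

theorem stepLaw_real_Ioi (ha : ∀ k < N, a (k + 1) < a k) (hN : ∀ k, N ≤ k → a k = 0) (m : ℕ) :
    (stepLaw a N).real (Ioi (m : ℝ)) = a m := by
  have hterm (k : ℕ) : volume (Ioi (m : ℝ) ∩ Ioc (k : ℝ) ((k : ℝ) + 1)) =
      if m ≤ k then 1 else 0 := by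
    split_ifs with h
    · have : Ioi (m : ℝ) ∩ Ioc (k : ℝ) ((k : ℝ) + 1) = Ioc (k : ℝ) ((k : ℝ) + 1) :=
        inter_eq_right.2 fun x hx => lt_of_le_of_lt (Nat.cast_le.2 h) hx.1
      rw [this, Real.volume_Ioc]; simp
    · have h' : (k : ℝ) + 1 ≤ m := by exact_mod_cast not_le.1 h
      have : Ioi (m : ℝ) ∩ Ioc (k : ℝ) ((k : ℝ) + 1) = ∅ :=
        eq_empty_of_forall_notMem fun x hx => absurd hx.1 (not_lt.2 (hx.2.2.trans h'))
      rw [this, measure_empty]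
  rw [measureReal_def, stepLaw_apply measurableSet_Ioi, ENNReal.toReal_sum fun k _ =>
    ENNReal.mul_ne_top ENNReal.ofReal_ne_top (by rw [hterm]; split_ifs <;> simp)]
  have hterm' : ∀ k ∈ Finset.range N, (ENNReal.ofReal (a k - a (k + 1)) *
      volume (Ioi (m : ℝ) ∩ Ioc (k : ℝ) ((k : ℝ) + 1))).toReal =
      if m ≤ k then a k - a (k + 1) else 0 := by
    intro k hk
    rw [hterm, ENNReal.toReal_mul,
      ENNReal.toReal_ofReal (sub_nonneg.2 (ha k (Finset.mem_range.1 hk)).le)]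
    split_ifs <;> simp
  rw [Finset.sum_congr rfl hterm', ← Finset.sum_filter]
  have : (Finset.range N).filter (m ≤ ·) = Finset.Ico m N := by
    ext k; simp [and_comm]
  rw [this]
  rcases le_total m N with h | h
  · have h' := Finset.sum_Ico_sub a h
    rw [← sub_zero (a m), ← hN N le_rfl, ← neg_sub, ← h', ← Finset.sum_neg_distrib]
    exact Finset.sum_congr rfl fun k _ => (neg_sub _ _).symm
  · rw [Finset.Ico_eq_empty_of_le h, Finset.sum_empty, hN m h]

theorem isAdmissibleMarginal_stepLaw (ha : ∀ k < N, a (k + 1) < a k) (h0 : a 0 = 1)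
    (hN : a N = 0) : IsAdmissibleMarginal (stepLaw a N) := by
  have hprob : IsProbabilityMeasure (stepLaw a N) := by
    constructor
    rw [stepLaw_apply MeasurableSet.univ]
    have : ∀ k ∈ Finset.range N, ENNReal.ofReal (a k - a (k + 1)) *
        volume (univ ∩ Ioc (k : ℝ) ((k : ℝ) + 1)) = ENNReal.ofReal (a k - a (k + 1)) := by
      intro k _
      simp
    rw [Finset.sum_congr rfl this, ← ENNReal.ofReal_sum_of_nonneg fun k hk =>
      sub_nonneg.2 (ha k (Finset.mem_range.1 hk)).le, Finset.sum_range_sub', h0, hN]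
    simp
  refine ⟨hprob, ?_, ?_, ?_⟩
  · refine Measure.AbsolutelyContinuous.mk fun s hs h => ?_
    rw [stepLaw_apply hs]
    refine Finset.sum_eq_zero fun k _ => ?_
    rw [measure_mono_null inter_subset_left h, mul_zero]
  · have hsupp : (stepLaw a N).support ⊆ Icc 0 (N : ℝ) := by
      refine Measure.support_subset_of_isClosed isClosed_Icc ?_
      rw [mem_ae_iff, stepLaw_apply measurableSet_Icc.compl]
      refine Finset.sum_eq_zero fun k hk => ?_
      have hk' : (k : ℝ) + 1 ≤ N := by exact_mod_cast Finset.mem_range.1 hk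
      have : (Icc 0 (N : ℝ))ᶜ ∩ Ioc (k : ℝ) ((k : ℝ) + 1) = ∅ :=
        eq_empty_of_forall_notMem fun x hx => hx.1 ⟨(Nat.cast_nonneg k).trans hx.2.1.le,
          hx.2.2.trans hk'⟩
      rw [this, measure_empty, mul_zero]
    intro x hx y hy hxy
    have hx := hsupp hx
    have hy := hsupp hy
    have hk1 := Nat.floor_le hx.1
    have hk2 := Nat.lt_floor_add_one x
    have hkN : ⌊x⌋₊ < N := by
      rw [Nat.floor_lt hx.1]
      exact hxy.trans_le hy.2
    -- The unit cell containing `x` has positive density and meets `(x, y]` in positive length. So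
    -- the cdf increases strictly on all of `[0, N]`, not merely on the support.
    have hpos : 0 < stepLaw a N (Ioc x y) := by
      rw [stepLaw_apply measurableSet_Ioc]
      refine lt_of_lt_of_le ?_ (Finset.single_le_sum (f := fun k : ℕ =>
        ENNReal.ofReal (a k - a (k + 1)) * volume (Ioc x y ∩ Ioc (k : ℝ) ((k : ℝ) + 1)))
        (fun _ _ => zero_le) (Finset.mem_range.2 hkN))
      refine ENNReal.mul_pos (by simpa using ha _ hkN) ?_
      rw [Ioc_inter_Ioc, Real.volume_Ioc]
      simp only [ne_eq, ENNReal.ofReal_eq_zero, not_le, sub_pos]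
      exact max_lt (lt_min hxy hk2) (lt_min (hk1.trans_lt hxy) (by linarith))
    have h := measureReal_sdiff (μ := stepLaw a N) (Iic_subset_Iic.2 hxy.le) measurableSet_Iic
    rw [Iic_sdiff_Iic] at h
    rw [ProbabilityTheory.cdf_eq_real, ProbabilityTheory.cdf_eq_real]
    have : 0 < (stepLaw a N).real (Ioc x y) := ENNReal.toReal_pos hpos.ne' (measure_ne_top _ _)
    linarith
  · unfold stepLaw
    refine integrable_finsetSum_measure.2 fun k _ => ?_
    refine Integrable.smul_measure ?_ ENNReal.ofReal_ne_top
    exact (continuous_id.integrableOn_Icc).mono_set Ioc_subset_Icc_self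

/-- The uniform law on `(0, 1]`. -/
noncomputable def uniformLaw : Measure ℝ := volume.restrict (Ioc 0 1)

theorem isAdmissibleMarginal_uniformLaw : IsAdmissibleMarginal uniformLaw := by
  have h : stepLaw (fun k => if k = 0 then 1 else 0) 1 = uniformLaw := by
    simp [stepLaw, uniformLaw]
  rw [← h]
  exact isAdmissibleMarginal_stepLaw (by simp) (by simp) (by simp)

theorem uniformLaw_real_Ioi (t : ℝ) : uniformLaw.real (Ioi t) = max (1 - max t 0) 0 := by
  rw [uniformLaw, measureReal_restrict_apply measurableSet_Ioi, inter_comm, Ioc_inter_Ioi,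
    Real.volume_real_Ioc, max_comm 0 t]

end StepLaw

/-! ### Random utility and random rankings -/

section RandomUtility

variable {n : ℕ}

theorem rumSet_subset_regSet (𝒮 : Set (Assortment n)) : rumSet 𝒮 ⊆ regSet 𝒮 := by
  rintro p ⟨ν, θ, hθ, htie, hp⟩
  refine ⟨fun S i => ?_, fun S => ?_, fun S T h i => ?_⟩
  · rw [hp]; exact measureReal_nonneg
  · have hsum : ∑ i, p S i = ∑ i ∈ S.1.1, θ.real (argmaxEvent ν S.1 i) := by
      rw [← Finset.sum_coe_sort S.1.1 fun i => θ.real (argmaxEvent ν S.1 i)]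
      exact Finset.sum_congr rfl fun i _ => hp S i
    rw [hsum, ← measureReal_biUnion_finset (pairwiseDisjoint_argmaxEvent ν S.1 _)
      fun i _ => measurableSet_argmaxEvent ν S.1 i, measureReal_def, ENNReal.toReal_eq_one_iff,
      ← mem_ae_iff_prob_eq_one (Finset.measurableSet_biUnion _
        fun i _ => measurableSet_argmaxEvent ν S.1 i)]
    have hnt : ∀ᵐ ε ∂θ, ∀ i j : Fin n, i ≠ j → ν i + ε i ≠ ν j + ε j := by
      refine ae_all_iff.2 fun i => ae_all_iff.2 fun j => ?_
      by_cases hij : i = j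
      · simp [hij]
      · have := htie i j hij
        rw [ae_iff]
        simpa [hij] using this
    filter_upwards [hnt] with ε hε
    obtain ⟨i, hi, hmax⟩ := S.1.1.exists_max_image (fun i => ν i + ε i) S.1.2
    exact mem_biUnion hi ⟨hi, fun j hj hji => lt_of_le_of_ne (hmax j hj) (hε j i hji)⟩
  · rw [hp, hp]
    exact measureReal_mono fun ε hε => ⟨i.2, fun j hj => hε.2 j (h hj)⟩

theorem restrict_mem_rumSet {𝒮 : Set (Assortment n)} {p : ChoiceData 𝒮}
    {q : ChoiceData (univ : Set (Assortment n))} (hq : q ∈ rumSet univ)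
    (h : ∀ S i, p S i = q ⟨S.1, mem_univ _⟩ i) : p ∈ rumSet 𝒮 := by
  obtain ⟨ν, θ, hθ, htie, hqθ⟩ := hq
  exact ⟨ν, θ, hθ, htie, fun S i => by rw [h, hqθ]⟩

variable {Ω : Type} [Fintype Ω] {w : Ω → ℝ}

/-- The law with finitely many atoms `u ω` of mass `w ω`. -/
noncomputable def atomicLaw (w : Ω → ℝ) (u : Ω → Fin n → ℝ) : Measure (Fin n → ℝ) :=
  ∑ ω, ENNReal.ofReal (w ω) • Measure.dirac (u ω)

open Classical in
theorem atomicLaw_apply (w : Ω → ℝ) (u : Ω → Fin n → ℝ) {s : Set (Fin n → ℝ)}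
    (hs : MeasurableSet s) :
    atomicLaw w u s = ∑ ω, if u ω ∈ s then ENNReal.ofReal (w ω) else 0 := by
  simp [atomicLaw, Measure.finsetSum_apply, Measure.dirac_apply' _ hs, indicator_apply]

open Classical in
theorem atomicLaw_real_apply (hw : ∀ ω, 0 ≤ w ω) (u : Ω → Fin n → ℝ) {s : Set (Fin n → ℝ)}
    (hs : MeasurableSet s) :
    (atomicLaw w u).real s = ∑ ω, if u ω ∈ s then w ω else 0 := by
  rw [measureReal_def, atomicLaw_apply w u hs, ENNReal.toReal_sum]
  · refine Finset.sum_congr rfl fun ω _ => ?_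
    split_ifs
    · exact ENNReal.toReal_ofReal (hw ω)
    · rfl
  · intro ω _
    split_ifs <;> simp

/-- Points of the random utility model from a finite mixture of rankings. -/
theorem mem_rumSet_of_ranks {𝒮 : Set (Assortment n)} {p : ChoiceData 𝒮} (hw : ∀ ω, 0 ≤ w ω)
    (hw1 : ∑ ω, w ω = 1) (r : Ω → Fin n → ℕ)
    (hr : ∀ ω, w ω ≠ 0 → Function.Injective (r ω))
    (hp : ∀ S i, p S i =
      ∑ ω, if ∀ j ∈ S.1.1, j ≠ i.1 → r ω j < r ω i.1 then w ω else 0) :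
    p ∈ rumSet 𝒮 := by
  classical
  refine ⟨0, atomicLaw w fun ω i => (r ω i : ℝ), ⟨?_⟩, fun i j hij => ?_, fun S i => ?_⟩
  · rw [atomicLaw_apply _ _ MeasurableSet.univ]
    simp [← ENNReal.ofReal_sum_of_nonneg fun ω _ => hw ω, hw1]
  · rw [atomicLaw_apply _ _ (measurableSet_eq_fun (by fun_prop) (by fun_prop))]
    refine Finset.sum_eq_zero fun ω _ => ?_
    by_cases h0 : w ω = 0
    · simp [h0]
    · have := (hr ω h0).ne hij
      simp [this]
  · rw [hp, atomicLaw_real_apply hw _ (measurableSet_argmaxEvent _ _ _)]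
    refine Finset.sum_congr rfl fun ω _ => if_congr ?_ rfl rfl
    simp [argmaxEvent]

/-- Splitting the weights `w` along a choice from `a` with law `q` which follows `X` as long as
`X` lies in `a`. -/
theorem exists_splitting (hw : ∀ ω, 0 ≤ w ω) (hw1 : ∑ ω, w ω = 1) (X : Ω → Option (Fin n))
    (a : Finset (Fin n)) (q : Fin n → ℝ) (hq1 : ∑ i ∈ a, q i = 1)
    (h : ∀ i ∈ a, (∑ ω, if X ω = some i then w ω else 0) ≤ q i) :
    ∃ v : Ω → Fin n → ℝ, (∀ ω i, 0 ≤ v ω i) ∧ (∀ ω, ∑ i, v ω i = w ω) ∧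
      (∀ ω i, v ω i ≠ 0 → i ∈ a ∧ ∀ j ∈ a, X ω = some j → i = j) ∧
      ∀ i ∈ a, ∑ ω, v ω i = q i := by
  classical
  -- `m i` is the mass already forced onto `i`, and `R` the mass left free. The deficits `q i - m i`
  -- sum to `R`, so free mass is split in proportion to them.
  set m : Fin n → ℝ := fun i => ∑ ω, if X ω = some i then w ω else 0 with hm
  set g : Ω → Prop := fun ω => ∃ j ∈ a, X ω = some j with hg
  set R : ℝ := ∑ ω, if g ω then 0 else w ω with hRdef
  have hin (ω : Ω) : (∑ i ∈ a, if X ω = some i then w ω else 0) = if g ω then w ω else 0 := by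
    split_ifs with hω
    · obtain ⟨j, hj, hX⟩ := hω
      rw [Finset.sum_eq_single_of_mem j hj, if_pos hX]
      intro i _ hij
      rw [if_neg]
      rw [hX]
      exact fun h => hij (Option.some_injective _ h).symm
    · exact Finset.sum_eq_zero fun i hi => if_neg fun hX => hω ⟨i, hi, hX⟩
  have hR : ∑ i ∈ a, (q i - m i) = R := by
    rw [Finset.sum_sub_distrib, hq1, hm, Finset.sum_comm, Finset.sum_congr rfl fun ω _ => hin ω,
      ← hw1, ← Finset.sum_sub_distrib]
    refine Finset.sum_congr rfl fun ω _ => ?_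
    split_ifs <;> simp
  have hr (i) (hi : i ∈ a) : 0 ≤ q i - m i := sub_nonneg.2 (h i hi)
  have hR0 : 0 ≤ R := by rw [← hR]; exact Finset.sum_nonneg hr
  have hv0 (ω) (i) (hi : i ∈ a) : 0 ≤ (if X ω = some i then w ω else 0) +
      (if g ω then 0 else w ω * ((q i - m i) / R)) := by
    refine add_nonneg ?_ ?_
    · split_ifs
      · exact hw ω
      · exact le_rfl
    · split_ifs
      · exact le_rfl
      · exact mul_nonneg (hw ω) (div_nonneg (hr i hi) hR0)
  refine ⟨fun ω i => if i ∈ a then (if X ω = some i then w ω else 0) +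
    (if g ω then 0 else w ω * ((q i - m i) / R)) else 0, fun ω i => ?_, fun ω => ?_,
    fun ω i hv => ?_, fun i hi => ?_⟩
  · by_cases hi : i ∈ a
    · exact (hv0 ω i hi).trans_eq (if_pos hi).symm
    · exact (if_neg hi).ge
  · rw [Finset.sum_ite_mem, Finset.univ_inter, Finset.sum_add_distrib, hin]
    by_cases hω : g ω
    · simp [hω]
    · simp only [hω, if_false, zero_add]
      rw [← Finset.mul_sum, ← Finset.sum_div, hR]
      -- Division by `R = 0` gives zero shares, which is harmless: every free `ω` then has weight
      -- zero.
      by_cases hRz : R = 0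
      · have := (Finset.sum_eq_zero_iff_of_nonneg fun ω _ => by
          split_ifs
          · exact le_rfl
          · exact hw ω).1 hRz ω (Finset.mem_univ _)
        rw [if_neg hω] at this
        rw [this, zero_mul]
      · rw [div_self hRz, mul_one]
  · by_cases hi : i ∈ a
    · refine ⟨hi, fun j hj hX => ?_⟩
      by_contra hij
      refine hv ?_
      have hgω : g ω := ⟨j, hj, hX⟩
      dsimp only
      rw [if_pos hi, if_pos hgω, if_neg, add_zero]
      rw [hX]
      exact fun h => hij (Option.some_injective _ h).symm
    · exact absurd (if_neg hi) hv
  · simp only [hi, if_true]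
    rw [Finset.sum_add_distrib]
    have : (∑ ω, if g ω then 0 else w ω * ((q i - m i) / R)) = R * ((q i - m i) / R) := by
      rw [hRdef, Finset.sum_mul]
      refine Finset.sum_congr rfl fun ω _ => ?_
      split_ifs <;> simp
    rw [this]
    by_cases hRz : R = 0
    · have := (Finset.sum_eq_zero_iff_of_nonneg hr).1 (hR.trans hRz) i hi
      rw [hRz, zero_mul, add_zero]
      linarith
    · rw [mul_div_cancel₀ _ hRz]
      ring

/-- Regular choice probabilities on a laminar family come from a random choice function which, on
a smaller assortment, keeps the choice from a larger one as long as it is available. -/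
theorem exists_consistent_choice (A : Finset (Assortment n)) (p : Assortment n → Fin n → ℝ)
    (hlam : IsLaminar (A : Set (Assortment n)))
    (hnonneg : ∀ S ∈ A, ∀ i ∈ S.1, 0 ≤ p S i) (hsum : ∀ S ∈ A, ∑ i ∈ S.1, p S i = 1)
    (hreg : ∀ S ∈ A, ∀ T ∈ A, S.1 ⊆ T.1 → ∀ i ∈ S.1, p T i ≤ p S i) :
    ∃ (Ω : Type) (_ : Fintype Ω) (w : Ω → ℝ) (c : Ω → Assortment n → Fin n),
      (∀ ω, 0 ≤ w ω) ∧ ∑ ω, w ω = 1 ∧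
      (∀ ω, w ω ≠ 0 → (∀ S ∈ A, c ω S ∈ S.1) ∧
        ∀ S ∈ A, ∀ T ∈ A, S.1 ⊆ T.1 → c ω T ∈ S.1 → c ω S = c ω T) ∧
      ∀ S ∈ A, ∀ i ∈ S.1, p S i = ∑ ω, if c ω S = i then w ω else 0 := by
  classical
  -- The inserted assortment has minimal size, so it contains none of the others and only has to
  -- agree with its supersets.
  induction A using Finset.induction_on_min_value (f := fun S : Assortment n => S.1.card) with
  | empty => exact ⟨Unit, inferInstance, fun _ => 1, fun _ S => S.2.choose, by simp, by simp,
      by simp, by simp⟩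
  | insert a s has hmin ih =>
    have hsub {S} (hS : S ∈ s) : S ∈ insert a s := Finset.mem_insert_of_mem hS
    have ha := Finset.mem_insert_self a s
    obtain ⟨Ω, _, w, c, hw, hw1, hc, hp⟩ := ih
      (fun S hS T hT => hlam S (hsub hS) T (hsub hT))
      (fun S hS => hnonneg S (hsub hS)) (fun S hS => hsum S (hsub hS))
      (fun S hS T hT => hreg S (hsub hS) T (hsub hT))
    have hnot {T} (hT : T ∈ s) : ¬ T.1 ⊆ a.1 := fun h => has <| by
      have : T = a := Subtype.ext (Finset.eq_of_subset_of_card_le h (hmin T hT))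
      rwa [← this]
    -- The choice to follow is that from the smallest superset of `a`. By laminarity the supersets
    -- form a chain, so consistency with this one gives consistency with all; `none` means that
    -- there is no superset.
    obtain ⟨X, hX, hXc⟩ : ∃ X : Ω → Option (Fin n),
        (∀ i ∈ a.1, (∑ ω, if X ω = some i then w ω else 0) ≤ p a i) ∧
        ∀ ω, w ω ≠ 0 → ∀ T ∈ s, a.1 ⊆ T.1 → c ω T ∈ a.1 → X ω = some (c ω T) := by
      by_cases hpar : (s.filter fun T => a.1 ⊆ T.1).Nonempty
      · obtain ⟨T₀, hT₀, hT₀min⟩ := Finset.exists_min_image _ (fun T => T.1.card) hpar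
        obtain ⟨hT₀s, haT₀⟩ := Finset.mem_filter.1 hT₀
        refine ⟨fun ω => some (c ω T₀), fun i hi => ?_, fun ω hω T hT haT hcT => ?_⟩
        · simp only [Option.some.injEq]
          rw [← hp T₀ hT₀s i (haT₀ hi)]
          exact hreg a ha T₀ (hsub hT₀s) haT₀ i hi
        · have hTT : T₀.1 ⊆ T.1 := by
            rcases hlam T₀ (hsub hT₀s) T (hsub hT) with h | h | h
            · exact h
            · exact (Finset.eq_of_subset_of_card_le h
                (hT₀min T (Finset.mem_filter.2 ⟨hT, haT⟩))).ge
            · obtain ⟨x, hx⟩ := a.2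
              exact absurd (haT hx) (Finset.disjoint_left.1 h (haT₀ hx))
          exact congrArg some ((hc ω hω).2 T₀ hT₀s T hT hTT (haT₀ hcT))
      · refine ⟨fun _ => none, fun i hi => by simpa using hnonneg a ha i hi,
          fun ω _ T hT haT => ?_⟩
        exact absurd ⟨T, Finset.mem_filter.2 ⟨hT, haT⟩⟩ hpar
    obtain ⟨v, hv, hvw, hva, hvp⟩ := exists_splitting hw hw1 X a.1 (p a) (hsum a ha) hX
    have hne {ω i} (h : v ω i ≠ 0) : w ω ≠ 0 := fun h0 => h <|
      (Finset.sum_eq_zero_iff_of_nonneg fun i _ => hv ω i).1 ((hvw ω).trans h0) i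
        (Finset.mem_univ _)
    have hup {T} (hT : T ∈ s) (ω : Ω) (i : Fin n) : Function.update (c ω) a i T = c ω T :=
      Function.update_of_ne (by rintro rfl; exact has hT) _ _
    refine ⟨Ω × Fin n, inferInstance, fun x => v x.1 x.2,
      fun x => Function.update (c x.1) a x.2, fun x => hv _ _, ?_, ?_, ?_⟩
    · rw [Fintype.sum_prod_type, ← hw1]
      exact Finset.sum_congr rfl fun ω _ => hvw ω
    · rintro ⟨ω, i⟩ hx
      have hω := hne hx
      obtain ⟨hia, hiX⟩ := hva ω i hx
      refine ⟨fun S hS => ?_, fun S hS T hT hST hcT => ?_⟩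
      · rcases Finset.mem_insert.1 hS with rfl | hS
        · simpa using hia
        · dsimp only
          rw [hup hS]; exact (hc ω hω).1 S hS
      · rcases Finset.mem_insert.1 hS with rfl | hS' <;>
          rcases Finset.mem_insert.1 hT with rfl | hT'
        · rfl
        · dsimp only at hcT ⊢
          rw [hup hT'] at hcT ⊢
          rw [Function.update_self]
          exact hiX _ hcT (hXc ω hω T hT' hST hcT)
        · exact absurd hST (hnot hS')
        · dsimp only at hcT ⊢
          rw [hup hT'] at hcT ⊢
          rw [hup hS']
          exact (hc ω hω).2 S hS' T hT' hST hcT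
    · intro S hS k hk
      rw [Fintype.sum_prod_type]
      rcases Finset.mem_insert.1 hS with rfl | hS
      · simp only [Function.update_self, Finset.sum_ite_eq', Finset.mem_univ, if_true]
        exact (hvp k hk).symm
      · simp only [hup hS]
        rw [hp S hS k hk]
        refine Finset.sum_congr rfl fun ω _ => ?_
        split_ifs
        · exact (hvw ω).symm
        · simp

/-- A consistent choice is induced by a ranking: rank each product by the size of the largest
assortment from which it is chosen. -/
theorem regSet_subset_rumSet {𝒮 : Set (Assortment n)} (hlam : IsLaminar 𝒮) :
    regSet 𝒮 ⊆ rumSet 𝒮 := by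
  classical
  rintro p ⟨hnonneg, hsum, hreg⟩
  set A : Finset (Assortment n) := (Set.toFinite 𝒮).toFinset with hA
  have hmem {S} : S ∈ A ↔ S ∈ 𝒮 := by simp [hA]
  set f : Assortment n → Fin n → ℝ := fun S i =>
    if h : S ∈ 𝒮 ∧ i ∈ S.1 then p ⟨S, h.1⟩ ⟨i, h.2⟩ else 0 with hf
  have hfp (S : 𝒮) (i : {i // i ∈ S.1.1}) : f S.1 i.1 = p S i := dif_pos ⟨S.2, i.2⟩
  obtain ⟨Ω, _, w, c, hw, hw1, hc, hp⟩ := exists_consistent_choice A f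
    (fun S hS T hT => hlam S (by simpa [hA] using hS) T (by simpa [hA] using hT))
    (fun S hS i hi => (hnonneg ⟨S, hmem.1 hS⟩ ⟨i, hi⟩).trans_eq (hfp ⟨S, hmem.1 hS⟩ ⟨i, hi⟩).symm)
    (fun S hS => by
      rw [← Finset.sum_coe_sort, ← hsum ⟨S, hmem.1 hS⟩]
      exact Finset.sum_congr rfl fun i _ => hfp ⟨S, hmem.1 hS⟩ i)
    (fun S hS T hT hST i hi => by
      rw [hfp ⟨S, hmem.1 hS⟩ ⟨i, hi⟩, hfp ⟨T, hmem.1 hT⟩ ⟨i, hST hi⟩]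
      exact hreg ⟨S, hmem.1 hS⟩ ⟨T, hmem.1 hT⟩ hST ⟨i, hi⟩)
  set h : Ω → Fin n → ℕ := fun ω i => (A.filter fun S => c ω S = i).sup fun S => S.1.card with hh
  -- If `j ∈ S` is rejected from `S`, any `T` that selects `j` is a strict subset of `S`: a superset
  -- selecting `j` would force `S` to select it too.
  have hlt (ω) (hω : w ω ≠ 0) (S) (hS : S ∈ A) (j) (hj : j ∈ S.1) (hjc : j ≠ c ω S) :
      h ω j < h ω (c ω S) := by
    have h1 : S.1.card ≤ h ω (c ω S) :=
      Finset.le_sup (f := fun S : Assortment n => S.1.card) (Finset.mem_filter.2 ⟨hS, rfl⟩)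
    refine lt_of_lt_of_le ((Finset.sup_lt_iff S.2.card_pos).2 fun T hT => ?_) h1
    obtain ⟨hT, hTj⟩ := Finset.mem_filter.1 hT
    have hjT : j ∈ T.1 := hTj ▸ (hc ω hω).1 T hT
    rcases hlam S (hmem.1 hS) T (hmem.1 hT) with hST | hTS | hd
    · exact absurd (((hc ω hω).2 S hS T hT hST (hTj ▸ hj)).trans hTj).symm hjc
    · refine Finset.card_lt_card (Finset.ssubset_iff_subset_ne.2 ⟨hTS, fun hTS => hjc ?_⟩)
      rw [← hTj, Subtype.ext hTS]
    · exact absurd hjT (Finset.disjoint_left.1 hd hj)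
  -- The rank `h * n + i` is lexicographic, so indices only break ties between equal heights.
  have hrank {x y : ℕ} {i j : Fin n} (hxy : x < y) : x * n + i < y * n + j := by
    have := Nat.mul_le_mul_right n (Nat.succ_le_of_lt hxy)
    have := i.2
    rw [Nat.succ_mul] at *
    omega
  refine mem_rumSet_of_ranks hw hw1 (fun ω i => h ω i * n + i) (fun ω _ i j hij => ?_)
    fun S i => ?_
  · have := congrArg (· % n) hij
    simp only [Nat.mul_add_mod_self_right, Nat.mod_eq_of_lt i.2, Nat.mod_eq_of_lt j.2] at this
    exact Fin.ext this
  · rw [← hfp, hp S.1 (hmem.2 S.2) i.1 i.2]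
    refine Finset.sum_congr rfl fun ω _ => ?_
    by_cases hω : w ω = 0
    · simp [hω]
    refine if_congr ⟨?_, fun hi => ?_⟩ rfl rfl
    · rintro hi j hj hji
      rw [← hi] at hji ⊢
      exact hrank (hlt ω hω S.1 (hmem.2 S.2) j hj hji)
    · by_contra hne
      have h1 := hi _ ((hc ω hω).1 S.1 (hmem.2 S.2)) hne
      have h2 := hrank (i := i.1) (j := c ω S.1)
        (hlt ω hω S.1 (hmem.2 S.2) i.1 i.2 (Ne.symm hne))
      exact lt_asymm h1 h2

end RandomUtility

/-! ### Laminar families and the closure -/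

section Laminar

variable {n : ℕ}

theorem IsNested.isLaminar {𝒮 : Set (Assortment n)} (h : IsNested 𝒮) : IsLaminar 𝒮 :=
  fun S hS T hT => (h S hS T hT).imp_right Or.inl

theorem isClosed_regSet (𝒮 : Set (Assortment n)) : IsClosed (regSet 𝒮) := by
  simp only [regSet, ofPred_and, ofPred_forall]
  refine (isClosed_iInter fun S => isClosed_iInter fun i =>
    isClosed_le continuous_const (by fun_prop)).inter
    ((isClosed_iInter fun S => isClosed_eq (by fun_prop) continuous_const).inter
      (isClosed_iInter fun S => isClosed_iInter fun T => isClosed_iInter fun h =>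
        isClosed_iInter fun i => isClosed_le (by fun_prop) (by fun_prop)))

/-- On a laminar family, every regular point becomes a point of the marginal distribution model
when it is mixed with the uniform choice probabilities. -/
theorem mix_uniform_mem_mdmSet {𝒮 : Set (Assortment n)} (hlam : IsLaminar 𝒮) {p : ChoiceData 𝒮}
    (hp : p ∈ regSet 𝒮) {ε : ℝ} (h0 : 0 < ε) (h1 : ε < 1) :
    (fun S i => (1 - ε) * p S i + ε * (S.1.1.card : ℝ)⁻¹ : ChoiceData 𝒮) ∈ mdmSet 𝒮 := by
  classical
  obtain ⟨hnonneg, hsum, hreg⟩ := hp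
  have hle (S : 𝒮) (i) : p S i ≤ 1 := by
    rw [← hsum S]
    exact Finset.single_le_sum (fun j _ => hnonneg S j) (Finset.mem_univ i)
  have : Fintype 𝒮 := Fintype.ofFinite 𝒮
  set f : 𝒮 → Fin n → NNReal := fun S i =>
    if h : i ∈ S.1.1 then (p S ⟨i, h⟩).toNNReal else 0 with hf
  have hfp (S : 𝒮) (i : {i // i ∈ S.1.1}) : (f S i.1 : ℝ) = p S i := by
    rw [hf]
    simp only [i.2, dif_pos]
    exact Real.coe_toNNReal _ (hnonneg S i)
  -- The largest probability of `i` over assortments of size at least `k`; values in `NNReal` make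
  -- the empty supremum zero. At `k = S.1.1.card` it is attained at `S`, since by laminarity every
  -- competitor containing `i` contains `S`.
  set b : Fin n → ℕ → NNReal := fun i k =>
    (Finset.univ.filter fun S : 𝒮 => i ∈ S.1.1 ∧ k ≤ S.1.1.card).sup fun S => f S i with hb
  have hbanti (i) : Antitone (b i) := fun k l hkl =>
    Finset.sup_mono (Finset.monotone_filter_right _ fun S _ h => ⟨h.1, hkl.trans h.2⟩)
  have hb1 (i) (k) : b i k ≤ 1 := by
    refine Finset.sup_le fun S hS => ?_
    have := hfp S ⟨i, (Finset.mem_filter.1 hS).2.1⟩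
    rw [← NNReal.coe_le_coe, this]
    exact hle _ _
  have hbS (S : 𝒮) (i : {i // i ∈ S.1.1}) : (b i.1 S.1.1.card : ℝ) = p S i := by
    rw [← hfp S i, NNReal.coe_inj]
    refine le_antisymm (Finset.sup_le fun T hT => ?_)
      (Finset.le_sup (f := fun S => f S i.1) (Finset.mem_filter.2 ⟨Finset.mem_univ _, i.2, le_rfl⟩))
    obtain ⟨-, hiT, hcard⟩ := Finset.mem_filter.1 hT
    have hST : S.1.1 ⊆ T.1.1 := by
      rcases hlam S.1 S.2 T.1 T.2 with h | h | h
      · exact h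
      · exact (Finset.eq_of_subset_of_card_le h hcard).ge
      · exact absurd hiT (Finset.disjoint_left.1 h i.2)
    rw [← NNReal.coe_le_coe, hfp S i, hfp T ⟨i.1, hiT⟩]
    exact hreg S T hST i
  -- The tail at `m` serves assortments of size `m + 1`; the value one at `m = 0` is right for
  -- singletons. The term `ε / (m + 1)` makes the decrease strict.
  set a : Fin n → ℕ → ℝ := fun i m => if m = 0 then 1 else if m < n then
    (1 - ε) * b i (m + 1) + ε * ((m + 1 : ℕ) : ℝ)⁻¹ else 0 with ha
  have hazero (i) : a i 0 = 1 := if_pos rfl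
  have haN (i : Fin n) (k) (hk : n ≤ k) : a i k = 0 := by
    have : k ≠ 0 := by have := i.2; omega
    simp [ha, this, hk]
  have hastep (i) (k) (hk : k < n) : a i (k + 1) < a i k := by
    have hb0 (m) : (0 : ℝ) ≤ b i m := NNReal.coe_nonneg _
    have hinv : ((k + 1 + 1 : ℕ) : ℝ)⁻¹ < ((k + 1 : ℕ) : ℝ)⁻¹ :=
      inv_strictAnti₀ (by positivity) (by exact_mod_cast Nat.lt_succ_self _)
    have hstep : (1 - ε) * b i (k + 1 + 1) + ε * ((k + 1 + 1 : ℕ) : ℝ)⁻¹ <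
        (1 - ε) * b i (k + 1) + ε * ((k + 1 : ℕ) : ℝ)⁻¹ := by
      have : (b i (k + 1 + 1) : ℝ) ≤ b i (k + 1) := hbanti i (Nat.le_succ _)
      exact add_lt_add_of_le_of_lt (mul_le_mul_of_nonneg_left this (by linarith))
        (mul_lt_mul_of_pos_left hinv h0)
    have hpos : 0 < (1 - ε) * b i (k + 1) + ε * ((k + 1 : ℕ) : ℝ)⁻¹ :=
      add_pos_of_nonneg_of_pos (mul_nonneg (by linarith) (hb0 _)) (by positivity)
    have hak : (1 - ε) * b i (k + 1) + ε * ((k + 1 : ℕ) : ℝ)⁻¹ ≤ a i k := by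
      by_cases hk0 : k = 0
      · subst hk0
        have : (b i (0 + 1) : ℝ) ≤ 1 := hb1 i _
        rw [hazero]
        simp only [zero_add, Nat.cast_one, inv_one, mul_one] at this ⊢
        nlinarith
      · simp [ha, hk0, hk]
    refine lt_of_lt_of_le ?_ hak
    by_cases hk' : k + 1 < n
    · simpa only [ha, Nat.succ_ne_zero, if_false, hk', if_true] using hstep
    · rwa [haN i _ (not_lt.1 hk')]
  refine mem_mdmSet_of_thresholds (ν := 0) (F := fun i => stepLaw (a i) n)
    (fun i => isAdmissibleMarginal_stepLaw (hastep i) (hazero i) (haN i n le_rfl))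
    (fun S => ((S.1.1.card - 1 : ℕ) : ℝ)) (fun S => ?_) fun S i => ?_
  · have hc : (S.1.1.card : ℝ) ≠ 0 := by exact_mod_cast S.1.2.card_pos.ne'
    rw [Finset.sum_add_distrib, ← Finset.mul_sum, hsum S]
    simp only [Finset.sum_const, Finset.card_univ, Fintype.card_coe, nsmul_eq_mul]
    field_simp
    ring
  · have hpos := S.1.2.card_pos
    have hcn : S.1.1.card ≤ n := (Finset.card_le_univ _).trans_eq (Fintype.card_fin n)
    simp only [excess, Pi.zero_apply, sub_zero]
    rw [stepLaw_real_Ioi (hastep i) (haN i)]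
    by_cases hc : S.1.1.card - 1 = 0
    · have hc1 : S.1.1.card = 1 := by omega
      have : p S i = 1 := by
        rw [← hsum S]
        have hsub : Subsingleton {i // i ∈ S.1.1} :=
          ⟨fun x y => Subtype.ext (Finset.card_le_one.1 hc1.le _ x.2 _ y.2)⟩
        rw [Fintype.sum_subsingleton _ i]
      rw [hc, hazero, this, hc1]
      simp
    · have hlt : S.1.1.card - 1 < n := by omega
      simp only [ha, hc, hlt, if_true, if_false]
      rw [Nat.sub_add_cancel hpos, hbS]

theorem regSet_subset_closure_mdmSet {𝒮 : Set (Assortment n)} (hlam : IsLaminar 𝒮) :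
    regSet 𝒮 ⊆ closure (mdmSet 𝒮) := by
  intro p hp
  have hcont : Continuous fun ε : ℝ =>
      (fun S i => (1 - ε) * p S i + ε * (S.1.1.card : ℝ)⁻¹ : ChoiceData 𝒮) := by
    fun_prop
  have hlim : Tendsto (fun ε : ℝ =>
      (fun S i => (1 - ε) * p S i + ε * (S.1.1.card : ℝ)⁻¹ : ChoiceData 𝒮)) (𝓝[>] 0) (𝓝 p) := by
    have := (hcont.tendsto 0).mono_left (nhdsWithin_le_nhds (s := Ioi 0))
    simpa using this
  refine mem_closure_of_tendsto hlim ?_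
  filter_upwards [Ioo_mem_nhdsGT (zero_lt_one' ℝ)] with ε hε
  exact mix_uniform_mem_mdmSet hlam hp hε.1 hε.2

theorem closure_mdmSet_eq_regSet {𝒮 : Set (Assortment n)} (hlam : IsLaminar 𝒮) :
    closure (mdmSet 𝒮) = regSet 𝒮 :=
  (closure_minimal (mdmSet_subset_regSet 𝒮) (isClosed_regSet 𝒮)).antisymm
    (regSet_subset_closure_mdmSet hlam)

theorem rumSet_eq_regSet {𝒮 : Set (Assortment n)} (hlam : IsLaminar 𝒮) :
    rumSet 𝒮 = regSet 𝒮 :=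
  (rumSet_subset_regSet 𝒮).antisymm (regSet_subset_rumSet hlam)

end Laminar

/-! ### Two products -/

section TwoProducts

theorem isLaminar_two (𝒮 : Set (Assortment 2)) : IsLaminar 𝒮 := by
  have h : ∀ S T : Finset (Fin 2), S ⊆ T ∨ T ⊆ S ∨ Disjoint S T := by decide
  exact fun S _ T _ => h S.1 T.1

theorem regSet_two_subset_mdmSet (𝒮 : Set (Assortment 2)) : regSet 𝒮 ⊆ mdmSet 𝒮 := by
  classical
  rintro p ⟨hnonneg, hsum, -⟩
  have hle (S : 𝒮) (i) : p S i ≤ 1 := by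
    rw [← hsum S]
    exact Finset.single_le_sum (fun j _ => hnonneg S j) (Finset.mem_univ i)
  set U : Assortment 2 := ⟨Finset.univ, Finset.univ_nonempty⟩ with hU
  -- The uniform tail at `1 - ν i` is `ν i`, so threshold one reproduces the pair's probabilities,
  -- and threshold zero serves singletons. If the pair is absent, any value in `[0, 1]` would do.
  set ν : Fin 2 → ℝ := fun i =>
    if h : U ∈ 𝒮 then p ⟨U, h⟩ ⟨i, Finset.mem_univ i⟩ else 0 with hν
  have hν0 (i) : 0 ≤ ν i := by
    by_cases h : U ∈ 𝒮
    · simp [hν, h, hnonneg]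
    · simp [hν, h]
  have hν1 (i) : ν i ≤ 1 := by
    by_cases h : U ∈ 𝒮
    · simp [hν, h, hle]
    · simp [hν, h]
  refine mem_mdmSet_of_thresholds (ν := ν) (F := fun _ => uniformLaw)
    (fun _ => isAdmissibleMarginal_uniformLaw)
    (fun S => if S.1.1.card = 1 then 0 else 1) hsum fun S i => ?_
  unfold excess
  rw [uniformLaw_real_Ioi]
  by_cases hc : S.1.1.card = 1
  · have : p S i = 1 := by
      rw [← hsum S]
      have hsub : Subsingleton {i // i ∈ S.1.1} :=
        ⟨fun x y => Subtype.ext (Finset.card_le_one.1 hc.le _ x.2 _ y.2)⟩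
      rw [Fintype.sum_subsingleton _ i]
    rw [if_pos hc, this, show max (0 - ν i.1) 0 = 0 from max_eq_right (by linarith [hν0 i.1])]
    simp
  · have hSU : S.1 = U := by
      refine Subtype.ext ((Finset.card_eq_iff_eq_univ _).1 ?_)
      have h1 := S.1.2.card_pos
      have h2 : S.1.1.card ≤ 2 := (Finset.card_le_univ _).trans_eq (Fintype.card_fin 2)
      simp only [Fintype.card_fin]
      omega
    have hpν : p S i = ν i.1 := by
      obtain ⟨S, hS⟩ := S
      dsimp only at hSU
      subst hSU
      simp only [hν, dif_pos hS]
    rw [if_neg hc, hpν, max_eq_left (sub_nonneg.2 (hν1 i.1)), sub_sub_cancel,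
      max_eq_left (hν0 i.1)]

end TwoProducts

/-! ### Three products -/

section ThreeProducts

theorem regSet_three_subset_rumSet : regSet (univ : Set (Assortment 3)) ⊆ rumSet univ := by
  classical
  rintro p ⟨hnonneg, hsum, hreg⟩
  set f : Finset (Fin 3) → Fin 3 → ℝ := fun S i =>
    if h : i ∈ S then p ⟨⟨S, ⟨i, h⟩⟩, mem_univ _⟩ ⟨i, h⟩ else 0 with hf
  have hfp (S : (univ : Set (Assortment 3))) (i : {i // i ∈ S.1.1}) : p S i = f S.1.1 i.1 := by
    simp only [hf, i.2, dif_pos]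
  have hfsum (S : Finset (Fin 3)) (hS : S.Nonempty) : ∑ i ∈ S, f S i = 1 := by
    rw [← hsum ⟨⟨S, hS⟩, mem_univ _⟩, ← Finset.sum_coe_sort]
    exact Finset.sum_congr rfl fun i _ => (hfp ⟨⟨S, hS⟩, mem_univ _⟩ i).symm
  have hf0 (S) (i) : 0 ≤ f S i := by
    by_cases h : i ∈ S
    · simp only [hf, h, dif_pos]; exact hnonneg _ _
    · simp [hf, h]
  have hfreg (S T) (h : S ⊆ T) (i) (hi : i ∈ S) : f T i ≤ f S i := by
    simp only [hf, hi, h hi, dif_pos]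
    exact hreg ⟨⟨S, ⟨i, hi⟩⟩, mem_univ _⟩ ⟨⟨T, ⟨i, h hi⟩⟩, mem_univ _⟩ h ⟨i, hi⟩
  clear_value f
  clear hf
  have s0 := hfsum {0} (by decide)
  have s1 := hfsum {1} (by decide)
  have s2 := hfsum {2} (by decide)
  have s01 := hfsum {0, 1} (by decide)
  have s02 := hfsum {0, 2} (by decide)
  have s12 := hfsum {1, 2} (by decide)
  have s012 := hfsum {0, 1, 2} (by decide)
  rw [Finset.sum_singleton] at s0 s1 s2
  rw [Finset.sum_pair (by decide)] at s01 s02 s12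
  rw [Finset.sum_insert (by decide), Finset.sum_pair (by decide)] at s012
  have r1 := hfreg {1, 2} {0, 1, 2} (by decide) 1 (by decide)
  have r2 := hfreg {1, 2} {0, 1, 2} (by decide) 2 (by decide)
  have r3 := hfreg {0, 2} {0, 1, 2} (by decide) 0 (by decide)
  have r4 := hfreg {0, 2} {0, 1, 2} (by decide) 2 (by decide)
  have r5 := hfreg {0, 1} {0, 1, 2} (by decide) 0 (by decide)
  have r6 := hfreg {0, 1} {0, 1, 2} (by decide) 1 (by decide)
  have hcases : ∀ S : Finset (Fin 3), S.Nonempty → S = {0} ∨ S = {1} ∨ S = {2} ∨ S = {0, 1} ∨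
      S = {0, 2} ∨ S = {1, 2} ∨ S = {0, 1, 2} := by decide
  refine mem_rumSet_of_ranks (Ω := Fin 6)
    -- The ranking `x > y > z` gets the probability that `y` beats `z` but is not best of all, that
    -- is `f {y, z} y - f {x, y, z} y`; regularity makes it nonnegative.
    (w := ![f {1, 2} 1 - f {0, 1, 2} 1, f {1, 2} 2 - f {0, 1, 2} 2,
      f {0, 2} 0 - f {0, 1, 2} 0, f {0, 2} 2 - f {0, 1, 2} 2,
      f {0, 1} 0 - f {0, 1, 2} 0, f {0, 1} 1 - f {0, 1, 2} 1]) (fun ω => ?_) ?_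
    ![![2, 1, 0], ![2, 0, 1], ![1, 2, 0], ![0, 2, 1], ![1, 0, 2], ![0, 1, 2]]
    (fun ω _ => ?_) fun S i => ?_
  · fin_cases ω <;> simp [*]
  · simp [Fin.sum_univ_six]
    linarith
  · exact (by decide : ∀ ω, Function.Injective ((![![2, 1, 0], ![2, 0, 1], ![1, 2, 0], ![0, 2, 1],
      ![1, 0, 2], ![0, 1, 2]] : Fin 6 → Fin 3 → ℕ) ω)) ω
  · rw [hfp]
    obtain ⟨⟨S, hS⟩, -⟩ := S
    obtain ⟨i, hi⟩ := i
    dsimp only at hi ⊢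
    rcases hcases S hS with rfl | rfl | rfl | rfl | rfl | rfl | rfl <;> fin_cases i <;>
      simp [Fin.sum_univ_six] at hi ⊢ <;> linarith

/-- The six weights involve all pairs and the full set, so the data is first extended to every
assortment. -/
theorem mdmSet_three_subset_rumSet (𝒮 : Set (Assortment 3)) : mdmSet 𝒮 ⊆ rumSet 𝒮 := by
  intro p hp
  obtain ⟨q, hq, hpq⟩ := exists_extension_of_mem_mdmSet hp
  exact restrict_mem_rumSet (regSet_three_subset_rumSet (mdmSet_subset_regSet _ hq)) hpq

end ThreeProducts

/-! ### Points separating the two models, and a common point -/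

section Comparison

variable {n : ℕ}

/-- The equal mixture of a ranking and its reverse is not a point of the marginal distribution
model on a collection with two assortments `{i, j}` and `{i, j, k}`. -/
theorem not_rumSet_subset_mdmSet {𝒮 : Set (Assortment n)} {i j k : Fin n} (hij : i < j)
    (hjk : j < k) (hS : ⟨{i, j}, Finset.insert_nonempty _ _⟩ ∈ 𝒮)
    (hT : ⟨{i, j, k}, Finset.insert_nonempty _ _⟩ ∈ 𝒮) : ¬ rumSet 𝒮 ⊆ mdmSet 𝒮 := by
  intro h
  -- Under the order and its reverse, `i` has probability one half in both assortments. The middle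
  -- product `j` wins half the time against `i` alone, but never among the three.
  set r : Bool → Fin n → ℕ := fun ω l => if ω then l else n - l with hr
  set p : ChoiceData 𝒮 := fun S l =>
    ∑ ω, if ∀ m ∈ S.1.1, m ≠ l.1 → r ω m < r ω l.1 then (1 / 2 : ℝ) else 0 with hp
  have hmem : p ∈ rumSet 𝒮 := by
    refine mem_rumSet_of_ranks (fun _ => by norm_num) (by norm_num) r (fun ω _ l m hlm => ?_)
      fun S l => rfl
    have := l.2
    have := m.2
    cases ω <;> simp [hr] at hlm <;> omega
  have hik := hij.trans hjk
  have := k.2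
  have f1 : n - (j : ℕ) < n - i := by omega
  have f2 : n - (k : ℕ) < n - i := by omega
  have h1 := eq_of_mem_mdmSet (h hmem) (S := ⟨_, hS⟩) (T := ⟨_, hT⟩) (i := i) (by simp) (by simp)
  have e1 : p ⟨_, hS⟩ ⟨i, by simp⟩ = 1 / 2 := by
    simp [hp, hr, hij.ne', hij.le, f1]
  have e2 : p ⟨_, hT⟩ ⟨i, by simp⟩ = 1 / 2 := by
    simp [hp, hr, hij.ne', hik.ne', hik.le, f1, f2]
  have e3 : p ⟨_, hS⟩ ⟨j, by simp⟩ = 1 / 2 := by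
    simp [hp, hr, hij.ne, hij, f1.le]
  have e4 : p ⟨_, hT⟩ ⟨j, by simp⟩ = 0 := by
    simp [hp, hr, hij.ne, hjk.ne', hij, hjk.not_gt, f1.not_gt]
  have := h1 (by rw [e1, e2]) (by rw [e1]; norm_num) (by rw [e1]; norm_num) (j := j)
    (by simp) (by simp)
  rw [e3, e4] at this
  norm_num at this

theorem mdmSet_inter_rumSet_nonempty (𝒮 : Set (Assortment n)) :
    (mdmSet 𝒮 ∩ rumSet 𝒮).Nonempty := by
  classical
  -- Always choosing the largest index is a single ranking. With utilities spaced by one and uniform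
  -- noise on `(0, 1]`, the largest index as threshold gives tails one and zero.
  set p : ChoiceData 𝒮 := fun S i => if i.1 = S.1.1.max' S.1.2 then 1 else 0 with hp
  refine ⟨p, ?_, ?_⟩
  · refine mem_mdmSet_of_thresholds (ν := fun i => (i : ℝ)) (F := fun _ => uniformLaw)
      (fun _ => isAdmissibleMarginal_uniformLaw) (fun S => (S.1.1.max' S.1.2 : ℝ))
      (fun S => ?_) fun S i => ?_
    · rw [Finset.sum_eq_single ⟨S.1.1.max' S.1.2, Finset.max'_mem _ _⟩]
      · simp [hp]
      · intro i _ hi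
        exact if_neg fun h => hi (Subtype.ext h)
      · simp
    · unfold excess
      rw [uniformLaw_real_Ioi]
      have hle := S.1.1.le_max' i.1 i.2
      simp only [hp]
      split_ifs with h
      · rw [h]; simp
      · have hlt : i.1 < S.1.1.max' S.1.2 := lt_of_le_of_ne hle h
        have : (i.1 : ℝ) + 1 ≤ (S.1.1.max' S.1.2 : ℝ) := by exact_mod_cast hlt
        rw [max_eq_right]
        linarith [le_max_left ((S.1.1.max' S.1.2 : ℝ) - (i.1 : ℝ)) 0]
  · refine mem_rumSet_of_ranks (Ω := Unit) (w := fun _ => 1) (by simp) (by simp)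
      (fun _ i => i) (fun _ _ => Fin.val_injective) fun S i => ?_
    simp only [hp, Finset.univ_unique, Finset.sum_singleton]
    refine if_congr ⟨fun h j hj hji => ?_, fun h => ?_⟩ rfl rfl
    · rw [h] at hji ⊢
      exact Fin.lt_def.1 (lt_of_le_of_ne (S.1.1.le_max' j hj) hji)
    · by_contra hne
      exact absurd (S.1.1.le_max' i.1 i.2) (not_le.2 (h _ (Finset.max'_mem _ _) (Ne.symm hne)))

/-- A supermodularity property of the choice probabilities under random utility. -/
theorem add_le_add_of_mem_rumSet {𝒮 : Set (Assortment n)} {p : ChoiceData 𝒮} (hp : p ∈ rumSet 𝒮)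
    {S T T' U : 𝒮} (hST : S.1.1 ⊆ T.1.1) (hST' : S.1.1 ⊆ T'.1.1)
    (hU : U.1.1 ⊆ T.1.1 ∪ T'.1.1) {i : Fin n} (hS : i ∈ S.1.1) (hT : i ∈ T.1.1)
    (hT' : i ∈ T'.1.1) (hiU : i ∈ U.1.1) :
    p T ⟨i, hT⟩ + p T' ⟨i, hT'⟩ ≤ p S ⟨i, hS⟩ + p U ⟨i, hiU⟩ := by
  obtain ⟨ν, θ, hθ, -, h⟩ := hp
  simp only [h]
  rw [← measureReal_union_add_inter (measurableSet_argmaxEvent ν T'.1 i)]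
  refine add_le_add (measureReal_mono ?_) (measureReal_mono ?_)
  · rintro ε (hε | hε)
    · exact ⟨hS, fun j hj => hε.2 j (hST hj)⟩
    · exact ⟨hS, fun j hj => hε.2 j (hST' hj)⟩
  · rintro ε ⟨hε, hε'⟩
    exact ⟨hiU, fun j hj => (Finset.mem_union.1 (hU hj)).elim (hε.2 j) (hε'.2 j)⟩

/-- The values at `0, …, 4` of the tail functions of the marginal laws in a point of the marginal
distribution model which violates supermodularity. -/
noncomputable def tailTable : ℕ → ℕ → ℝ
  | _, 0 => 1
  | 0, 1 => 0.3
  | 0, 2 => 0.28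
  | 0, 3 => 0.1
  | 1, 1 => 0.7
  | 1, 2 => 0.32
  | 1, 3 => 0.2
  | _, 1 => 0.7
  | _, 2 => 0.4
  | _, 3 => 0.35
  | _, _ => 0

theorem tailTable_step (i : ℕ) : ∀ k < 4, tailTable i (k + 1) < tailTable i k := by
  intro k hk
  rcases i with _ | _ | i <;> interval_cases k <;> norm_num [tailTable]

theorem tailTable_eq_zero (i : ℕ) (k : ℕ) (hk : 4 ≤ k) : tailTable i k = 0 := by
  obtain ⟨k, rfl⟩ := Nat.exists_eq_add_of_le' hk
  rcases i with _ | _ | i <;> rfl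

theorem exists_incomparable (hn : 4 ≤ n) : ∃ 𝒮 : Set (Assortment n),
    ¬ mdmSet 𝒮 ⊆ rumSet 𝒮 ∧ ¬ rumSet 𝒮 ⊆ mdmSet 𝒮 := by
  classical
  let a : Fin n := ⟨0, by omega⟩
  let b : Fin n := ⟨1, by omega⟩
  let c : Fin n := ⟨2, by omega⟩
  let d : Fin n := ⟨3, by omega⟩
  have hab : a ≠ b := by simp [a, b]
  have hac : a ≠ c := by simp [a, c]
  have had : a ≠ d := by simp [a, d]
  have hbc : b ≠ c := by simp [b, c]
  have hbd : b ≠ d := by simp [b, d]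
  have hcd : c ≠ d := by simp [c, d]
  let S₁ : Assortment n := ⟨{a, b}, Finset.insert_nonempty _ _⟩
  let S₂ : Assortment n := ⟨{a, b, c}, Finset.insert_nonempty _ _⟩
  let S₃ : Assortment n := ⟨{a, b, d}, Finset.insert_nonempty _ _⟩
  let S₄ : Assortment n := ⟨{a, b, c, d}, Finset.insert_nonempty _ _⟩
  let 𝒮 : Set (Assortment n) := {S₁, S₂, S₃, S₄}
  have m1 : S₁ ∈ 𝒮 := by simp [𝒮]
  have m2 : S₂ ∈ 𝒮 := by simp [𝒮]
  have m3 : S₃ ∈ 𝒮 := by simp [𝒮]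
  have m4 : S₄ ∈ 𝒮 := by simp [𝒮]
  refine ⟨𝒮, fun h => ?_, not_rumSet_subset_mdmSet (i := a) (j := b) (k := c)
    (by simp [a, b]) (by simp [b, c]) m1 m2⟩
  have c1 : S₁.1.card = 2 := by simp [S₁, hab]
  have c2 : S₂.1.card = 3 := by simp [S₂, hab, hac, hbc]
  have c3 : S₃.1.card = 3 := by simp [S₃, hab, had, hbd]
  have c4 : S₄.1.card = 4 := by simp [S₄, hab, hac, hbc, had, hbd, hcd]
  -- Thresholds are sizes minus one. Products `c` and `d` share their tails, so `S₂` and `S₃` have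
  -- the same threshold, and the tails sum to one over each of the four assortments.
  set p : ChoiceData 𝒮 := fun S i => tailTable i.1 (S.1.1.card - 1) with hp
  have hmem : p ∈ mdmSet 𝒮 := by
    refine mem_mdmSet_of_thresholds (ν := 0) (F := fun i => stepLaw (tailTable i) 4)
      (fun i => isAdmissibleMarginal_stepLaw (tailTable_step i) (by simp [tailTable])
        (tailTable_eq_zero i 4 le_rfl)) (fun S => ((S.1.1.card - 1 : ℕ) : ℝ)) (fun S => ?_)
      fun S i => ?_
    · have : ∑ i, p S i = ∑ i ∈ S.1.1, tailTable i (S.1.1.card - 1) :=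
        Finset.sum_coe_sort S.1.1 fun i => tailTable i (S.1.1.card - 1)
      rw [this]
      obtain ⟨S, rfl | rfl | rfl | rfl⟩ := S
      · rw [c1, Finset.sum_pair hab]
        norm_num [a, b, tailTable]
      · rw [c2, Finset.sum_insert (by simp [hab, hac]), Finset.sum_pair hbc]
        norm_num [a, b, c, tailTable]
      · rw [c3, Finset.sum_insert (by simp [hab, had]), Finset.sum_pair hbd]
        norm_num [a, b, d, tailTable]
      · rw [c4, Finset.sum_insert (by simp [hab, hac, had]),
          Finset.sum_insert (by simp [hbc, hbd]), Finset.sum_pair hcd]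
        norm_num [a, b, c, d, tailTable]
    · simp only [excess, Pi.zero_apply, sub_zero]
      rw [stepLaw_real_Ioi (tailTable_step i) (tailTable_eq_zero i)]
  -- For product `a` this would say `0.28 + 0.28 ≤ 0.3 + 0.1`.
  have hineq := add_le_add_of_mem_rumSet (h hmem) (S := ⟨S₁, m1⟩) (T := ⟨S₂, m2⟩)
    (T' := ⟨S₃, m3⟩) (U := ⟨S₄, m4⟩) (i := a)
    (by intro x; simp [S₁, S₂]; tauto) (by intro x; simp [S₁, S₃]; tauto)
    (by intro x; simp [S₂, S₃, S₄]) (by simp [S₁]) (by simp [S₂]) (by simp [S₃])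
    (by simp [S₄])
  simp only [hp, c1, c2, c3, c4] at hineq
  norm_num [a, tailTable] at hineq

end Comparison

end ChoiceModels

theorem theorem3 :
    -- two products: the two models represent the same choice probabilities
    (∀ 𝒮 : Set (ChoiceModels.Assortment 2),
      ChoiceModels.rumSet 𝒮 = ChoiceModels.mdmSet 𝒮) ∧
    -- three products: the first set is contained in the second, for some collections strictly
    (∀ 𝒮 : Set (ChoiceModels.Assortment 3),
      ChoiceModels.mdmSet 𝒮 ⊆ ChoiceModels.rumSet 𝒮) ∧
    (∃ 𝒮 : Set (ChoiceModels.Assortment 3),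
      ChoiceModels.mdmSet 𝒮 ⊂ ChoiceModels.rumSet 𝒮) ∧
    -- four or more products: the sets always meet, and for some collections neither contains
    -- the other
    (∀ n : ℕ, 4 ≤ n →
      (∀ 𝒮 : Set (ChoiceModels.Assortment n),
        (ChoiceModels.mdmSet 𝒮 ∩ ChoiceModels.rumSet 𝒮).Nonempty) ∧
      ∃ 𝒮 : Set (ChoiceModels.Assortment n),
        ¬ ChoiceModels.mdmSet 𝒮 ⊆ ChoiceModels.rumSet 𝒮 ∧
        ¬ ChoiceModels.rumSet 𝒮 ⊆ ChoiceModels.mdmSet 𝒮) ∧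
    -- nested or laminar collections, any number of products
    (∀ (n : ℕ) (𝒮 : Set (ChoiceModels.Assortment n)),
      ChoiceModels.IsNested 𝒮 ∨ ChoiceModels.IsLaminar 𝒮 →
        ChoiceModels.rumSet 𝒮 = closure (ChoiceModels.mdmSet 𝒮) ∧
        closure (ChoiceModels.mdmSet 𝒮) = ChoiceModels.regSet 𝒮) := by
  refine ⟨fun 𝒮 => ?_, ChoiceModels.mdmSet_three_subset_rumSet,
    ⟨Set.univ, ChoiceModels.mdmSet_three_subset_rumSet _, ?_⟩,
    fun n hn => ⟨ChoiceModels.mdmSet_inter_rumSet_nonempty, ChoiceModels.exists_incomparable hn⟩,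
    fun n 𝒮 h => ?_⟩
  · exact ((ChoiceModels.rumSet_subset_regSet 𝒮).trans
      (ChoiceModels.regSet_two_subset_mdmSet 𝒮)).antisymm
      ((ChoiceModels.mdmSet_subset_regSet 𝒮).trans
        (ChoiceModels.regSet_subset_rumSet (ChoiceModels.isLaminar_two 𝒮)))
  · exact ChoiceModels.not_rumSet_subset_mdmSet (i := 0) (j := 1) (k := 2) (by decide) (by decide)
      (Set.mem_univ _) (Set.mem_univ _)
  · have hlam : ChoiceModels.IsLaminar 𝒮 := h.elim ChoiceModels.IsNested.isLaminar id
    rw [ChoiceModels.closure_mdmSet_eq_regSet hlam]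
    exact ⟨ChoiceModels.rumSet_eq_regSet hlam, rfl⟩
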